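/- **Lemma 2.8.** There is a computable function $p\colon\mathbb N\to\mathbb N$ such that the following holds for every field $K$ and all integers $n,r\ge 0$. Let $\mathbf A=(A_1,\dots,A_n)$ and $T$ be variables, and for $1\le i\le r$ let $f_i\in K[\mathbf A,T]$ be an absolutely irreducible polynomial that is separable and of degree $d_i$ as a polynomial in $T$ over $E=K(\mathbf A)$. Let $L_i$ be a finite Galois extension of $K$ of degree $d_i$. Let $F$ be the splitting field over $E$ of $f=f_1\cdots f_r$, considered as a polynomial in $T$. Assume that $\mathrm{Gal}(F/E)\cong\prod_{i=1}^r S_{d_i}$ and that $F$ is a regular extension of $K$ (i.e. $K$ is algebraically closed in $F$; $F/K$ is automatically separable). Then there exist a nonzero polynomial $g\in K[\mathbf A]$, with zero set the proper algebraic subset $V\subset\mathbb A^n_K$ and complement $U=\mathbb A^n_K\smallsetminus V$, an absolutely irreducible normal affine $K$-variety $W'$, embedded as a closed subvariety of $\mathbb A_K^{n+3}$, and a finite étale $K$-morphism $\rho'\colon W'\to U$ such that: (a) $V$ and $W'$ are defined by polynomials over $K$ of bounded total degrees: the ideal of $W'$ in $K[X_1,\dots,X_{n+3}]$ is generated by a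 finite set $s$ of polynomials with $\deg g+\sum_{q\in s}\deg q\le p\bigl(\sum_{i=1}^r\deg f_i\bigr)$, where $\deg$ denotes total degree (for $f_i$, in the variables $\mathbf A,T$). (b) $\deg f_i(\mathbf a,T)=d_i$ for all $\mathbf a\in U(K)$ and $1\le i\le r$. (c) $\rho'(W'(K))$ is the set of all $\mathbf a\in U(K)$ such that, for every $1\le i\le r$, the field $L_i$ is generated over $K$ by a root of $f_i(\mathbf a,T)$. In particular, $f_i(\mathbf a,T)$ is irreducible of degree $d_i$ over $K$ for all $\mathbf a\in\rho'(W'(K))$ and $1\le i\le r$. (d) $|(\rho')^{-1}(\mathbf a)\cap W'(K)|=\prod_{i=1}^r d_i$ for all $\mathbf a\in\rho'(W'(K))$. -/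

import Mathlib

open Polynomial TensorProduct IntermediateField

universe u v

noncomputable section

/-- The field `E = K(A)` of rational functions in the variables `A = (A_1, …, A_n)`. -/
abbrev RatField (K : Type u) [Field K] (n : ℕ) : Type u :=
  FractionRing (MvPolynomial (Fin n) K)

/-- The total degree of `f ∈ K[A][T]` as a polynomial in the `n + 1` variables `T, A_1, …, A_n`. -/
def totalDeg {K : Type u} [Field K] {n : ℕ} (f : (MvPolynomial (Fin n) K)[X]) : ℕ :=
  ((MvPolynomial.finSuccEquiv K n).symm f).totalDegree

/-- `f ∈ K[A][T]` is absolutely irreducible: it is irreducible as a polynomial in `A, T`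
over the algebraic closure of `K`. -/
def AbsolutelyIrreducible {K : Type u} [Field K] {n : ℕ}
    (f : (MvPolynomial (Fin n) K)[X]) : Prop :=
  Irreducible (f.map (MvPolynomial.map (algebraMap K (AlgebraicClosure K))))

/-- `f ∈ K[A][T]`, regarded as a polynomial in `T` over the field `E = K(A)`. -/
def overRatFunc {K : Type u} [Field K] {n : ℕ} (f : (MvPolynomial (Fin n) K)[X]) :
    (RatField K n)[X] :=
  f.map (algebraMap (MvPolynomial (Fin n) K) (RatField K n))

/-- The specialization `f(a, T) ∈ K[T]` of `f ∈ K[A][T]` at a point `a ∈ Kⁿ`. -/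
def specialize {K : Type u} [Field K] {n : ℕ} (f : (MvPolynomial (Fin n) K)[X])
    (a : Fin n → K) : K[X] :=
  f.map (MvPolynomial.eval a)

/-- `L` is generated over `K` by a root of `q ∈ K[T]`. -/
def GeneratedByRoot {K : Type u} [Field K] (L : Type v) [Field L] [Algebra K L]
    (q : K[X]) : Prop :=
  ∃ x : L, aeval x q = 0 ∧ K⟮x⟯ = ⊤

/-- The coordinate ring `K[X_1, …, X_N] / I` of the closed subscheme of affine `N`-space
over `K` defined by the ideal `I`. -/
abbrev CoordRing {K : Type u} [Field K] {N : ℕ} (I : Ideal (MvPolynomial (Fin N) K)) : Type u :=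
  MvPolynomial (Fin N) K ⧸ I

/-- An affine scheme `Spec S` over `K` is an absolutely irreducible variety (that is,
geometrically integral): `S` is a finitely generated `K`-algebra that remains an integral domain
after extending the scalars to the algebraic closure of `K`. -/
def IsAbsIrredVariety (K : Type u) [Field K] (S : Type u) [CommRing S] [Algebra K S] : Prop :=
  Algebra.FiniteType K S ∧ IsDomain (AlgebraicClosure K ⊗[K] S)

/-- An affine variety `Spec S` is normal: its coordinate ring is an integral domain that is
integrally closed in its field of fractions. -/
def IsNormalVariety (S : Type u) [CommRing S] : Prop :=
  IsDomain S ∧ IsIntegrallyClosed S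

/-- The coordinate ring `K[A, g(A)⁻¹]` of the principal open subset `U = 𝔸ⁿ ∖ V` of affine
`n`-space, where `V` is the zero set of `g`. -/
abbrev OpenCoordRing {K : Type u} [Field K] {n : ℕ} (g : MvPolynomial (Fin n) K) : Type u :=
  Localization.Away g

/-- The set `U(K)` of the `K`-rational points of `U = 𝔸ⁿ ∖ V`, where `V` is the zero set
of `g`. -/
def openPoints {K : Type u} [Field K] {n : ℕ} (g : MvPolynomial (Fin n) K) : Set (Fin n → K) :=
  {a | MvPolynomial.eval a g ≠ 0}

/-- Evaluation of regular functions on the closed subscheme defined by `I` at a `K`-rational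
point `b`, that is, at a common zero of `I` in `K^N`. -/
def evalAt {K : Type u} [Field K] {N : ℕ} {I : Ideal (MvPolynomial (Fin N) K)}
    (b : MvPolynomial.zeroLocus K I) : CoordRing I →ₐ[K] K :=
  Ideal.Quotient.liftₐ I (MvPolynomial.aeval b.1) b.2

/-- The map on `K`-rational points `W'(K) → U(K) ⊆ Kⁿ` of the morphism `W' → U` of affine
`K`-schemes that is given on coordinate rings by `ρ`: the `j`-th coordinate of the image of `b` is
the value at `b` of the regular function `ρ(A_j)`. -/
def mapPoint {K : Type u} [Field K] {n N : ℕ} {g : MvPolynomial (Fin n) K}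
    {I : Ideal (MvPolynomial (Fin N) K)} (ρ : OpenCoordRing g →ₐ[K] CoordRing I)
    (b : MvPolynomial.zeroLocus K I) : Fin n → K :=
  fun j => evalAt b (ρ (algebraMap (MvPolynomial (Fin n) K) (OpenCoordRing g)
    (MvPolynomial.X j)))

end

/-!
The covering `W'` parametrizes, over a point `a`, the tuples of isomorphisms
`L_i ≅ K[T]/(f_i(a, T))`. Geometrically it is a twisted form of the covering whose function field is
`F`: let `Ω` be an algebraic closure of `E = K(A)`, let `H_i = Gal(L_i/K)`, and index the `d_i`
roots of `f_i` in `Ω`, multiplied by the leading coefficient of `f_i` to make them integral over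
`K[A]`, by `H_i`, say as `u_i(s)`. The absolute Galois group of `E` permutes the roots of `f_i` by
some `π_i`, and acts on `H_i` by left translation by its restriction `b_i` to `L_i`; so it acts on
`∏ Sym(H_i)` by `σ ↦ π σ b⁻¹`, and `W'` is the étale covering of an open part of affine space that
belongs to this Galois set.

It is made explicit by a primitive element. The twisted sums `y_σ = ∑_{i,s} μ_i(s) u_i(σ_i(s))`,
where `μ_i(s)` are the conjugates of an element of `K(A) L_i` (`twistedSum`, `conjFamily`), are
permuted in the same way, so that `h = ∏ (Y - y_σ)` has coefficients in `K[A]`. By the independence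
of characters the `y_σ` are distinct if the elements of `K(A) L_i` are combinations of a basis with
suitable powers of the first variable as coefficients (`exists_twistedSum_injective`,
`exists_parameter`). The polynomial `g` is the discriminant of `h` times the leading coefficients of
the `f_i`, and `W'` is given by `g(A) Z = 1`, `h(A, Y) = 0`, `W = 0`.

* Geometry. As the discriminant is inverted, `K[A, g⁻¹][Y]/(h)` is étale and normal
  (`etale_adjoinRoot`, `isIntegrallyClosed_adjoinRoot`). It stays a domain over the algebraic
  closure of `K` (`isDomain_tensorProduct_adjoinRoot`): as `F` is regular over `K` and has the full
  group `∏ S_{d_i}`, every `σ` is the action on the roots of an automorphism of `Ω` that fixes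
  given constants (`exists_extension_fixing`), so the constants do not break up the orbit of `y_1`.
* Rational points. As the `u_i(s)` and the `y_σ` are integral over `K[A]`, they can be reduced
  modulo a prime above a point `a` (`points_of_specialization`). A reduced twisted sum is rational
  exactly if each `σ_i` is a map of Galois sets from `H_i` to the roots of `f_i(a, T)`, that is, if
  it comes from a tuple of roots `x_i` which generate the `L_i`; the twisted sum is then a sum of
  traces (`bijOn_trace_roots`), and each `x_i` can be chosen in `d_i` ways.
* Degrees. The degrees are bounded through an extension of the total degree from `K[A]` to its
  integral extensions (`HasWeight`): the weight of a root is bounded by the coefficients of its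
  equation, that of a sum or product by the weights of the terms, and on `K[A]` the weight is the
  total degree (`totalDegree_le_of_hasWeight`). This makes the bound depend on `∑ deg f_i` only.
-/

noncomputable section

/-! ### Galois descent -/

section Descent

/-- Without separability the fixed elements are only purely inseparable over `E`; see
`exists_pow_mem_range_of_fixed`. -/
theorem mem_range_algebraMap_of_fixed {E Ω : Type*} [Field E] [Field Ω] [Algebra E Ω] [Normal E Ω]
    {z : Ω} (hs : IsSeparable E z) (hf : ∀ β : Ω ≃ₐ[E] Ω, β z = z) :
    ∃ e, algebraMap E Ω e = z := by
  by_contra hz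
  have h1 : z ∉ (⊥ : Subalgebra E Ω) := by rwa [Algebra.mem_bot]
  obtain ⟨w, hw, hc⟩ := (notMem_iff_exists_ne_and_isConjRoot hs (Normal.splits' z)).1 h1
  obtain ⟨β, hβ⟩ := hc.symm.exists_algEquiv
  exact hw (by rw [← hβ]; exact (hf β).symm)

/-- A fixed element of a normal extension is purely inseparable over the base field. -/
theorem exists_pow_mem_range_of_fixed {F Ω : Type*} [Field F] [Field Ω] [Algebra F Ω]
    [Normal F Ω] (q : ℕ) [ExpChar F q] {x : Ω} (hf : ∀ β : Ω ≃ₐ[F] Ω, β x = x) :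
    ∃ (k : ℕ) (e : F), algebraMap F Ω e = x ^ q ^ k := by
  have : ExpChar (separableClosure F Ω) q := expChar_of_injective_algebraMap
    (algebraMap F (separableClosure F Ω)).injective q
  obtain ⟨k, y, hy⟩ := IsPurelyInseparable.pow_mem (separableClosure F Ω) q x
  have hs : IsSeparable F (x ^ q ^ k) := by
    rw [← hy]; exact mem_separableClosure_iff.1 y.2
  obtain ⟨e, he⟩ := mem_range_algebraMap_of_fixed hs fun β => by rw [map_pow, hf]
  exact ⟨k, e, he⟩

variable {R E Ω : Type*} [CommRing R] [IsIntegrallyClosed R] [Field E] [Algebra R E]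
  [IsFractionRing R E] [Field Ω] [Algebra E Ω] [Algebra R Ω] [IsScalarTower R E Ω]

theorem mem_range_algebraMap_of_integral_of_fixed [Normal E Ω] {z : Ω} (hs : IsSeparable E z)
    (hi : IsIntegral R z) (hf : ∀ β : Ω ≃ₐ[E] Ω, β z = z) : ∃ r, algebraMap R Ω r = z := by
  obtain ⟨e, rfl⟩ := mem_range_algebraMap_of_fixed hs hf
  have : IsIntegral R e := (isIntegral_algebraMap_iff (algebraMap E Ω).injective).1 hi
  obtain ⟨r, rfl⟩ := IsIntegrallyClosed.isIntegral_iff.1 this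
  exact ⟨r, IsScalarTower.algebraMap_apply R E Ω r⟩

theorem exists_map_eq_of_coeff_fixed [Normal E Ω] {q : Polynomial Ω}
    (hs : ∀ k, IsSeparable E (q.coeff k)) (hi : ∀ k, IsIntegral R (q.coeff k))
    (hf : ∀ β : Ω ≃ₐ[E] Ω, q.map (β : Ω →+* Ω) = q) :
    ∃ p : R[X], p.map (algebraMap R Ω) = q := by
  rw [← mem_lifts, lifts_iff_coeff_lifts]
  intro k
  refine mem_range_algebraMap_of_integral_of_fixed (E := E) (hs k) (hi k) fun β => ?_
  have := congrArg (fun p => coeff p k) (hf β)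
  simpa using this

theorem coeff_prod_X_sub_C_mem {A ι : Type*} [CommRing A] (S : Subring A) (s : Finset ι)
    (y : ι → A) (hy : ∀ i ∈ s, y i ∈ S) (k : ℕ) : (∏ i ∈ s, (X - C (y i))).coeff k ∈ S := by
  have h : ∏ i ∈ s, (X - C (y i)) ∈ lifts S.subtype := by
    refine prod_mem fun i hi => ?_
    refine (lifts_iff_coeff_lifts _).2 fun j => ?_
    rw [Set.mem_range]
    refine ⟨⟨(X - C (y i)).coeff j, ?_⟩, rfl⟩
    rw [coeff_sub, coeff_X, coeff_C]
    refine S.sub_mem ?_ ?_ <;> split_ifs <;> simp [S.one_mem, S.zero_mem, hy i hi]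
  obtain ⟨a, ha⟩ := (lifts_iff_coeff_lifts _).1 h k
  rw [← ha]; exact a.2

theorem map_prod_X_sub_C {A B ι : Type*} [CommRing A] [CommRing B] (s : Finset ι) (y : ι → A)
    (φ : A →+* B) : (∏ i ∈ s, (X - C (y i))).map φ = ∏ i ∈ s, (X - C (φ (y i))) := by
  simp [Polynomial.map_prod]

theorem monic_of_map_eq_prod_X_sub_C {A B ι : Type*} [CommRing A] [CommRing B] (φ : A →+* B)
    (hφ : Function.Injective φ) {h : A[X]} (s : Finset ι) (y : ι → B)
    (e : h.map φ = ∏ i ∈ s, (X - C (y i))) : h.Monic := by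
  refine monic_of_injective hφ ?_
  rw [e]; exact monic_prod_of_monic _ _ fun i _ => monic_X_sub_C _

theorem natDegree_of_map_eq_prod_X_sub_C {A B ι : Type*} [CommRing A] [CommRing B] [Nontrivial B]
    (φ : A →+* B) (hφ : Function.Injective φ) {h : A[X]} (s : Finset ι) (y : ι → B)
    (e : h.map φ = ∏ i ∈ s, (X - C (y i))) : h.natDegree = s.card := by
  rw [← natDegree_map_eq_of_injective hφ, e, natDegree_finsetProd_X_sub_C_eq_card]

/-- A finite family of separable integral elements that is permuted by the automorphisms of `Ω`
over `E` is the family of roots of a polynomial over `R`. -/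
theorem exists_map_eq_prod_X_sub_C [Normal E Ω] {G : Type*} [Fintype G] {y : G → Ω}
    (hs : ∀ σ, IsSeparable E (y σ)) (hi : ∀ σ, IsIntegral R (y σ))
    (hperm : ∀ β : Ω ≃ₐ[E] Ω, ∃ π : Equiv.Perm G, ∀ σ, β (y σ) = y (π σ)) :
    ∃ h : R[X], h.map (algebraMap R Ω) = ∏ σ, (X - C (y σ)) := by
  refine exists_map_eq_of_coeff_fixed (E := E) ?_ ?_ ?_
  · intro k
    have := coeff_prod_X_sub_C_mem (separableClosure E Ω).toSubring Finset.univ y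
      (fun σ _ => mem_separableClosure_iff.2 (hs σ)) k
    exact mem_separableClosure_iff.1 this
  · intro k
    exact coeff_prod_X_sub_C_mem (integralClosure R Ω).toSubring Finset.univ y
      (fun σ _ => hi σ) k
  · intro β
    obtain ⟨π, hπ⟩ := hperm β
    rw [map_prod_X_sub_C]
    simp only [RingHom.coe_coe, hπ]
    exact Equiv.prod_comp π fun σ => X - C (y σ)

end Descent

/-! ### Degrees of algebraic functions -/

/-- The Rees subring of `K[A][s]` for the filtration of `K[A]` by the total degree: the
polynomials in `s` whose coefficient at `s ^ k` has total degree at most `k`. -/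
def reesSubring (σ K : Type*) [Field K] : Subring (MvPolynomial σ K)[X] where
  carrier := {p | ∀ k, (p.coeff k).totalDegree ≤ k}
  mul_mem' {p q} hp hq k := by
    rw [coeff_mul]
    refine MvPolynomial.totalDegree_finsetSum_le fun x hx => ?_
    have h1 := hp x.1
    have h2 := hq x.2
    have h3 := MvPolynomial.totalDegree_mul (p.coeff x.1) (q.coeff x.2)
    have h4 := Finset.HasAntidiagonal.mem_antidiagonal.1 hx
    omega
  one_mem' k := by
    rw [coeff_one]; split_ifs <;> simp
  add_mem' {p q} hp hq k := by
    rw [coeff_add]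
    exact (MvPolynomial.totalDegree_add _ _).trans (max_le (hp k) (hq k))
  zero_mem' k := by simp
  neg_mem' {p} hp k := by
    rw [coeff_neg, MvPolynomial.totalDegree_neg]; exact hp k

theorem C_mul_X_pow_mem_reesSubring {σ K : Type*} [Field K] {r : MvPolynomial σ K} {m : ℕ}
    (h : r.totalDegree ≤ m) : C r * X ^ m ∈ reesSubring σ K := by
  intro k
  rw [coeff_C_mul_X_pow]
  split_ifs with h'
  · omega
  · simp

section Weight

variable {σ K Ω : Type*} [Field K] [Field Ω] [Algebra (MvPolynomial σ K) Ω]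

variable (σ K Ω) in
/-- The map from the Rees subring of `K[A][s]` to `Ω[s]`. -/
def reesHom : reesSubring σ K →+* Polynomial Ω :=
  (mapRingHom (algebraMap (MvPolynomial σ K) Ω)).comp (reesSubring σ K).subtype

variable (σ K) in
/-- An element `z` of an extension of `K[A]` has weight `m` if `z s ^ m` is integral over the Rees
ring of `K[A]`. This extends the condition of having total degree at most `m` from `K[A]` to its
integral extensions. -/
def HasWeight (m : ℕ) (z : Ω) : Prop :=
  (reesHom σ K Ω).IsIntegralElem (C z * X ^ m)

theorem HasWeight.mono {m m' : ℕ} {z : Ω} (h : HasWeight σ K m z) (hm : m ≤ m') :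
    HasWeight σ K m' z := by
  have h1 : (reesHom σ K Ω).IsIntegralElem (X ^ (m' - m)) := by
    have := (reesHom σ K Ω).isIntegralElem_map
      (x := ⟨C 1 * X ^ (m' - m), C_mul_X_pow_mem_reesSubring (by simp)⟩)
    simpa [reesHom] using this
  have h2 := RingHom.IsIntegralElem.mul _ h h1
  rwa [mul_assoc, ← pow_add, Nat.add_sub_cancel' hm] at h2

theorem HasWeight.mul {m m' : ℕ} {z z' : Ω} (h : HasWeight σ K m z) (h' : HasWeight σ K m' z') :
    HasWeight σ K (m + m') (z * z') := by
  have := RingHom.IsIntegralElem.mul _ h h'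
  rwa [mul_mul_mul_comm, ← C_mul, ← pow_add] at this

theorem HasWeight.add {m : ℕ} {z z' : Ω} (h : HasWeight σ K m z) (h' : HasWeight σ K m z') :
    HasWeight σ K m (z + z') := by
  have := RingHom.IsIntegralElem.add _ h h'
  rwa [← add_mul, ← C_add] at this

theorem HasWeight.sub {m : ℕ} {z z' : Ω} (h : HasWeight σ K m z) (h' : HasWeight σ K m z') :
    HasWeight σ K m (z - z') := by
  have := RingHom.IsIntegralElem.sub _ h h'
  rwa [← sub_mul, ← C_sub] at this

theorem hasWeight_algebraMap {r : MvPolynomial σ K} {m : ℕ} (h : r.totalDegree ≤ m) :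
    HasWeight σ K m (algebraMap _ Ω r) := by
  have := (reesHom σ K Ω).isIntegralElem_map (x := ⟨_, C_mul_X_pow_mem_reesSubring h⟩)
  simpa [reesHom, HasWeight] using this

theorem hasWeight_zero {m : ℕ} : HasWeight σ K m (0 : Ω) := by
  simpa using hasWeight_algebraMap (Ω := Ω) (r := (0 : MvPolynomial σ K)) (m := m) (by simp)

theorem hasWeight_one {m : ℕ} : HasWeight σ K m (1 : Ω) := by
  simpa using hasWeight_algebraMap (Ω := Ω) (r := (1 : MvPolynomial σ K)) (m := m) (by simp)

theorem HasWeight.pow {m : ℕ} {z : Ω} (h : HasWeight σ K m z) (k : ℕ) :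
    HasWeight σ K (m * k) (z ^ k) := by
  induction k with
  | zero => simpa using hasWeight_one
  | succ k ih => rw [pow_succ, Nat.mul_succ]; exact ih.mul h

theorem HasWeight.sum {ι : Type*} {s : Finset ι} {m : ℕ} {z : ι → Ω}
    (h : ∀ i ∈ s, HasWeight σ K m (z i)) : HasWeight σ K m (∑ i ∈ s, z i) :=
  Finset.sum_induction z (HasWeight σ K m) (fun _ _ => HasWeight.add) hasWeight_zero h

theorem HasWeight.prod {ι : Type*} {s : Finset ι} {m : ℕ} {z : ι → Ω}
    (h : ∀ i ∈ s, HasWeight σ K m (z i)) : HasWeight σ K (m * s.card) (∏ i ∈ s, z i) := by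
  classical
  induction s using Finset.induction_on with
  | empty => simpa using hasWeight_one
  | insert i s hi ih =>
    rw [Finset.prod_insert hi, Finset.card_insert_of_notMem hi, Nat.mul_succ, add_comm]
    exact (h i (Finset.mem_insert_self _ _)).mul
      (ih fun j hj => h j (Finset.mem_insert_of_mem hj))

/-- A root of `T ^ d + a_1 T ^ (d - 1) + ⋯ + a_d` with `deg a_k ≤ k m` has weight `m`. -/
theorem hasWeight_of_root {p : (MvPolynomial σ K)[X]} (hp : p.Monic) {m : ℕ}
    (hc : ∀ k ≤ p.natDegree, (p.coeff k).totalDegree ≤ (p.natDegree - k) * m) {z : Ω}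
    (hz : aeval z p = 0) : HasWeight σ K m z := by
  classical
  set d := p.natDegree with hd
  let c : ℕ → reesSubring σ K := fun k => if h : k ≤ d then
    ⟨C (p.coeff k) * X ^ ((d - k) * m), C_mul_X_pow_mem_reesSubring (hc k h)⟩ else 0
  refine ⟨∑ k ∈ Finset.range (d + 1), monomial k (c k), ?_, ?_⟩
  · refine monic_of_natDegree_le_of_coeff_eq_one d ?_ ?_
    · refine natDegree_sum_le_of_forall_le _ _ fun k hk => ?_
      exact (natDegree_monomial_le _).trans (Finset.mem_range_succ_iff.1 hk)
    · rw [finsetSum_coeff]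
      simp only [coeff_monomial]
      rw [Finset.sum_ite_eq' (Finset.range (d + 1)) d c, if_pos (by simp)]
      simp only [c, le_refl, dif_pos]
      apply Subtype.ext
      simp [hd, hp.coeff_natDegree]
  · rw [eval₂_finsetSum]
    have h1 : ∀ k ∈ Finset.range (d + 1),
        eval₂ (reesHom σ K Ω) (C z * X ^ m) (monomial k (c k)) =
          C (algebraMap _ Ω (p.coeff k) * z ^ k) * X ^ (d * m) := by
      intro k hk
      have hk' := Finset.mem_range_succ_iff.1 hk
      have e : (d - k) * m + m * k = d * m := by
        rw [mul_comm m k, ← add_mul, Nat.sub_add_cancel hk']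
      rw [eval₂_monomial]
      simp only [c, dif_pos hk', reesHom, RingHom.comp_apply, Subring.subtype_apply,
        coe_mapRingHom, Polynomial.map_mul, Polynomial.map_pow, map_C, map_X, ← e, pow_add,
        pow_mul, C_mul, C_pow, mul_pow]
      ring
    rw [Finset.sum_congr rfl h1, ← Finset.sum_mul, ← map_sum]
    rw [aeval_eq_sum_range] at hz
    simp only [Algebra.smul_def] at hz
    rw [hz]; simp

theorem hasWeight_of_isIntegral [Algebra K Ω] [IsScalarTower K (MvPolynomial σ K) Ω] {z : Ω}
    (h : IsIntegral K z) : HasWeight σ K 0 z := by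
  obtain ⟨p, hp, hz⟩ := h
  refine hasWeight_of_root (p := p.map (algebraMap K (MvPolynomial σ K))) (hp.map _) ?_ ?_
  · intro k _
    simp [MvPolynomial.algebraMap_eq]
  · rw [aeval_map_algebraMap]; exact hz

/-- On `K[A]` itself the weight is the total degree. -/
theorem totalDegree_le_of_hasWeight
    (hinj : Function.Injective (algebraMap (MvPolynomial σ K) Ω)) {r : MvPolynomial σ K} {m : ℕ}
    (h : HasWeight σ K m (algebraMap _ Ω r)) : r.totalDegree ≤ m := by
  by_contra! hlt
  obtain ⟨P, hP, hz⟩ := h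
  have hr : r ≠ 0 := by rintro rfl; simp at hlt
  set M := P.natDegree
  have h1 : eval₂ (reesSubring σ K).subtype (C r * X ^ m) P = 0 := by
    apply map_injective _ hinj
    rw [Polynomial.map_zero, ← coe_mapRingHom, hom_eval₂]
    simpa [reesHom] using hz
  -- Comparing the coefficients at `s ^ (m M)` gives an equation of `r` over `K[A]` whose other
  -- terms all have smaller degree than `r ^ M`.
  have h2 := congrArg (fun q => coeff q (M * m)) h1
  simp only [eval₂_eq_sum_range, finsetSum_coeff, coeff_zero, mul_pow, ← C_pow, ← pow_mul] at h2
  have h3 : ∀ k ∈ Finset.range (M + 1), (((reesSubring σ K).subtype (P.coeff k)) *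
      (C (r ^ k) * X ^ (m * k))).coeff (M * m) =
        ((P.coeff k : (MvPolynomial σ K)[X]).coeff ((M - k) * m)) * r ^ k := by
    intro k hk
    have e : M * m = (M - k) * m + m * k := by
      rw [mul_comm m k, ← add_mul, Nat.sub_add_cancel (Finset.mem_range_succ_iff.1 hk)]
    rw [← mul_assoc, e, coeff_mul_X_pow, coeff_mul_C]; rfl
  rw [Finset.sum_congr rfl h3, Finset.sum_range_succ, hP.coeff_natDegree, Nat.sub_self,
    zero_mul] at h2
  simp only [OneMemClass.coe_one, coeff_one_zero, one_mul] at h2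
  have h4 : (r ^ M).totalDegree = M * r.totalDegree := by
    have key : ∀ j, (r ^ j).totalDegree = j * r.totalDegree := fun j => by
      induction j with
      | zero => simp
      | succ j ih =>
        rw [pow_succ, MvPolynomial.totalDegree_mul_of_isDomain (pow_ne_zero j hr) hr, ih]
        ring
    exact key M
  have hM : M ≠ 0 := by
    intro h0
    rw [h0] at h2
    simp at h2
  have h5 : r ^ M = -∑ k ∈ Finset.range M,
      ((P.coeff k : (MvPolynomial σ K)[X]).coeff ((M - k) * m)) * r ^ k := by
    linear_combination h2
  have h6 : (r ^ M).totalDegree ≤ M * r.totalDegree - 1 := by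
    rw [h5, MvPolynomial.totalDegree_neg]
    refine MvPolynomial.totalDegree_finsetSum_le fun k hk => ?_
    have hk' := Finset.mem_range.1 hk
    have h7 := (P.coeff k).2 ((M - k) * m)
    have h8 := MvPolynomial.totalDegree_mul
      ((P.coeff k : (MvPolynomial σ K)[X]).coeff ((M - k) * m)) (r ^ k)
    have h9 := MvPolynomial.totalDegree_pow r k
    obtain ⟨j, hj⟩ : ∃ j, M = k + j := ⟨M - k, by omega⟩
    have hj0 : 0 < j := by omega
    rw [hj] at h7 h8 ⊢
    simp only [Nat.add_sub_cancel_left] at h7 h8 ⊢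
    have h10 : j * m + j ≤ j * r.totalDegree := by nlinarith
    rw [add_mul]
    omega
  have : 0 < M * r.totalDegree := Nat.mul_pos (Nat.pos_of_ne_zero hM) (by omega)
  omega

theorem HasWeight.coeff_prod_X_sub_C {ι : Type*} {s : Finset ι} {m : ℕ} {z : ι → Ω}
    (h : ∀ i ∈ s, HasWeight σ K m (z i)) (k : ℕ) :
    HasWeight σ K (m * s.card) ((∏ i ∈ s, (X - C (z i))).coeff k) := by
  classical
  induction s using Finset.induction_on generalizing k with
  | empty =>
    rw [Finset.prod_empty, coeff_one]
    split_ifs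
    exacts [hasWeight_one, hasWeight_zero]
  | insert i s hi ih =>
    have ih' := ih fun j hj => h j (Finset.mem_insert_of_mem hj)
    rw [Finset.prod_insert hi, Finset.card_insert_of_notMem hi, Nat.mul_succ, sub_mul, coeff_sub,
      coeff_C_mul]
    refine HasWeight.sub ?_ ?_
    · cases k with
      | zero => simpa using hasWeight_zero
      | succ k => rw [coeff_X_mul]; exact (ih' k).mono (by omega)
    · rw [add_comm]; exact (h i (Finset.mem_insert_self _ _)).mul (ih' k)

end Weight

/-! ### Automorphisms with a prescribed action on the roots -/

section Automorphisms

theorem exists_perm_of_algEquiv {E Ω H : Type*} [Field E] [Field Ω] [Algebra E Ω] [Finite H]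
    {q : E[X]} {t : H → Ω} (ht : Function.Injective t)
    (hq : ∀ x, aeval x q = 0 ↔ ∃ s, t s = x) (β : Ω ≃ₐ[E] Ω) :
    ∃ π : Equiv.Perm H, ∀ s, β (t s) = t (π s) := by
  have h : ∀ s, ∃ s', t s' = β (t s) := fun s => by
    rw [← hq, aeval_algEquiv, AlgHom.comp_apply, (hq (t s)).2 ⟨s, rfl⟩]
    exact map_zero _
  choose π hπ using h
  have hinj : Function.Injective π := fun s s' e => by
    apply ht; apply β.injective; rw [← hπ, ← hπ, e]
  exact ⟨Equiv.ofBijective π (Finite.injective_iff_bijective.1 hinj), fun s => (hπ s).symm⟩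

theorem exists_restrict_of_normal {K L Ω : Type*} [Field K] [Field L] [Field Ω] [Algebra K L]
    [Algebra K Ω] [Normal K L] (ι : L →ₐ[K] Ω) (β : Ω ≃ₐ[K] Ω) :
    ∃ b : L ≃ₐ[K] L, ∀ x, β (ι x) = ι (b x) := by
  let : Algebra L Ω := ι.toRingHom.toAlgebra
  have : IsScalarTower K L Ω := IsScalarTower.of_algebraMap_eq fun x => (ι.commutes x).symm
  exact ⟨β.restrictNormal L, fun x => (AlgEquiv.restrictNormal_commutes β L x).symm⟩

/-- If the Galois group of a splitting field is as large as the numbers of roots of several factors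
permit, then it contains every family of permutations of the roots of the factors. -/
theorem exists_gal_of_card {E : Type*} [Field E] {p : E[X]} {J : Type*} [Finite J] {H : J → Type*}
    [∀ i, Finite (H i)] {q : J → E[X]} {t : ∀ i, H i → p.SplittingField}
    (ht : ∀ i, Function.Injective (t i)) (hq : ∀ i x, aeval x (q i) = 0 ↔ ∃ s, t i s = x)
    (hp : ∀ x : p.SplittingField, aeval x p = 0 → ∃ i s, t i s = x)
    (hcard : Nat.card p.Gal = Nat.card (∀ i, Equiv.Perm (H i))) (σ : ∀ i, Equiv.Perm (H i)) :
    ∃ γ : p.SplittingField ≃ₐ[E] p.SplittingField, ∀ i s, γ (t i s) = t i (σ i s) := by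
  have h := fun (γ : p.SplittingField ≃ₐ[E] p.SplittingField) i =>
    exists_perm_of_algEquiv (ht i) (hq i) γ
  choose π hπ using h
  have hinj : Function.Injective (π : p.Gal → _) := by
    intro γ γ' e
    refine Gal.ext p fun x hx => ?_
    obtain ⟨i, s, rfl⟩ := hp x (mem_rootSet.1 hx).2
    have h1 := hπ γ i s
    have h2 := hπ γ' i s
    rw [← e] at h2
    exact h1.trans h2.symm
  have hbij := (Nat.bijective_iff_injective_and_card (π : p.Gal → _)).2 ⟨hinj, hcard⟩
  obtain ⟨γ, hγ⟩ := hbij.2 σ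
  exact ⟨γ, fun i s => by rw [← hγ]; exact hπ γ i s⟩

/-- If `K` is algebraically closed in the normal extension `F` of `E`, then an automorphism of `F`
over `E` extends to an algebraically closed field so that given finitely many elements algebraic
over `K` are fixed: on a finite normal extension of `K` the automorphisms over `F` restrict to all
automorphisms over `K`, so an arbitrary extension can be corrected by one of them. -/
theorem exists_extension_fixing {K E F Ω : Type*} [Field K] [Field E] [Field F] [Field Ω]
    [Algebra K E] [Algebra K F] [Algebra K Ω] [Algebra E F] [Algebra E Ω] [Algebra F Ω]
    [IsScalarTower K E Ω] [IsScalarTower K F Ω] [IsScalarTower E F Ω]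
    [IsAlgClosed Ω] [Normal E Ω] (hreg : algebraicClosure K F = ⊥) (γ : F ≃ₐ[E] F)
    (S : Finset Ω) (hS : ∀ s ∈ S, IsIntegral K s) :
    ∃ α : Ω ≃ₐ[E] Ω, (∀ x : F, α (algebraMap F Ω x) = algebraMap F Ω (γ x)) ∧
      ∀ s ∈ S, α s = s := by
  have : Normal F Ω := Normal.tower_top_of_normal E F Ω
  let p : K[X] := ∏ s ∈ S, minpoly K s
  have hp0 : p ≠ 0 := Finset.prod_ne_zero_iff.2 fun s hs => minpoly.ne_zero (hS s hs)
  let K₁ : IntermediateField K Ω := adjoin K (p.rootSet Ω)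
  have : IsSplittingField K K₁ p := adjoin_rootSet_isSplittingField (IsAlgClosed.splits _)
  have : Normal K K₁ := Normal.of_isSplittingField p
  have : FiniteDimensional K K₁ := IsSplittingField.finiteDimensional K₁ p
  have hSK : ∀ s ∈ S, s ∈ K₁ := fun s hs => subset_adjoin _ _ <| by
    rw [mem_rootSet]
    refine ⟨hp0, ?_⟩
    simp only [p, map_prod]
    exact Finset.prod_eq_zero hs (minpoly.aeval K s)
  let rK : (Ω ≃ₐ[F] Ω) →* (K₁ ≃ₐ[K] K₁) :=
    (AlgEquiv.restrictNormalHom K₁).comp (AlgEquiv.restrictScalarsHom K)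
  have hrK : ∀ ε x, ((rK ε x : K₁) : Ω) = ε x := fun ε x =>
    AlgEquiv.restrictNormal_commutes (ε.restrictScalars K) K₁ x
  have hfull : ∀ δ : K₁ ≃ₐ[K] K₁, δ ∈ rK.range := by
    intro δ
    rw [← fixingSubgroup_fixedField rK.range, IntermediateField.mem_fixingSubgroup_iff]
    intro x hx
    have hx' : ∀ ε : Ω ≃ₐ[F] Ω, ε (x : Ω) = x := fun ε => by
      rw [← hrK]
      exact congrArg _ ((mem_fixedField_iff _ _).1 hx _ ⟨ε, rfl⟩)
    obtain ⟨q, hq⟩ := ExpChar.exists F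
    obtain ⟨k, e, he⟩ := exists_pow_mem_range_of_fixed q hx'
    have hxi : IsIntegral K (x : Ω) :=
      (Algebra.IsIntegral.isIntegral (R := K) x).map K₁.val
    have hei : IsIntegral K e := by
      have h1 : IsIntegral K (algebraMap F Ω e) := he ▸ hxi.pow _
      exact (isIntegral_algebraMap_iff (algebraMap F Ω).injective).1 h1
    have hbot : e ∈ (⊥ : IntermediateField K F) := by
      rw [← hreg, mem_algebraicClosure_iff']; exact hei
    obtain ⟨κ, rfl⟩ := mem_bot.1 hbot
    rw [← IsScalarTower.algebraMap_apply] at he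
    have hxκ : x ^ q ^ k = algebraMap K K₁ κ := by
      apply Subtype.ext
      simpa using he.symm
    have h2 : (δ x) ^ q ^ k = x ^ q ^ k := by
      rw [← map_pow, hxκ]; exact δ.commutes κ
    have : ExpChar K q := by
      have := expChar_of_injective_algebraMap (algebraMap F Ω).injective q
      exact (algebraMap K Ω).expChar (algebraMap K Ω).injective q
    have : ExpChar K₁ q := expChar_of_injective_algebraMap (algebraMap K K₁).injective q
    exact iterateFrobenius_inj K₁ q k h2
  let β : Ω ≃ₐ[E] Ω := γ.liftNormal Ω
  obtain ⟨ε, hε⟩ := hfull ((β.restrictScalars K).restrictNormal K₁)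
  refine ⟨β.trans (ε.restrictScalars E).symm, fun x => ?_, fun s hs => ?_⟩
  · change ε.symm (β _) = _
    rw [AlgEquiv.liftNormal_commutes]
    exact ε.symm.commutes _
  · change ε.symm (β s) = s
    rw [AlgEquiv.symm_apply_eq]
    have h1 := hrK ε ⟨s, hSK s hs⟩
    rw [hε] at h1
    have h2 := AlgEquiv.restrictNormal_commutes (β.restrictScalars K) K₁ ⟨s, hSK s hs⟩
    exact h2.symm.trans h1

end Automorphisms

/-! ### The étale algebra generated by a family of conjugates -/

section EtaleAlgebra

theorem prod_X_sub_C_dvd {Ω G : Type*} [Field Ω] [Fintype G] {y : G → Ω}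
    (hy : Function.Injective y) {p : Polynomial Ω} (hp : ∀ σ, p.eval (y σ) = 0) :
    ∏ σ, (X - C (y σ)) ∣ p :=
  Finset.prod_dvd_of_coprime (fun _ _ _ _ hne => pairwise_coprime_X_sub_C hy hne)
    fun σ _ => dvd_iff_isRoot.2 (hp σ)

variable {A E Ω G : Type*} [CommRing A] [Field E] [Algebra A E] [Field Ω] [Algebra E Ω]
  [Algebra A Ω] [IsScalarTower A E Ω] [Fintype G] {y : G → Ω} {h : A[X]}

theorem aeval_eq_zero_of_map_eq_prod {σ : G}
    (e : h.map (algebraMap A Ω) = ∏ σ, (X - C (y σ))) : aeval (y σ) h = 0 := by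
  rw [← eval_map_algebraMap, e, eval_prod]
  exact Finset.prod_eq_zero (Finset.mem_univ σ) (by simp)

/-- The embedding of the algebra `A[Y]/(h)` into `Ω` that sends `Y` to one of the roots of `h`. -/
def rootHom (e : h.map (algebraMap A Ω) = ∏ σ, (X - C (y σ))) (σ : G) :
    AdjoinRoot h →ₐ[A] Ω :=
  AdjoinRoot.liftAlgHom h (Algebra.ofId A Ω) (y σ) (aeval_eq_zero_of_map_eq_prod e)

theorem rootHom_mk (e : h.map (algebraMap A Ω) = ∏ σ, (X - C (y σ))) (σ : G) (p : A[X]) :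
    rootHom e σ (AdjoinRoot.mk h p) = aeval (y σ) p := by
  simp [rootHom, aeval_def]
  rfl

theorem algEquiv_aeval (α : Ω ≃ₐ[E] Ω) (z : Ω) (p : A[X]) :
    α (aeval z p) = aeval (α z) p :=
  (aeval_algHom_apply ((α : Ω →ₐ[E] Ω).restrictScalars A) z p).symm

theorem rootHom_injective (hA : Function.Injective (algebraMap A Ω)) (hy : Function.Injective y)
    (e : h.map (algebraMap A Ω) = ∏ σ, (X - C (y σ))) {σ₀ : G}
    (htrans : ∀ σ, ∃ α : Ω ≃ₐ[E] Ω, α (y σ₀) = y σ) : Function.Injective (rootHom e σ₀) := by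
  rw [injective_iff_map_eq_zero]
  intro x hx
  obtain ⟨p, rfl⟩ := AdjoinRoot.mk_surjective x
  rw [rootHom_mk] at hx
  rw [AdjoinRoot.mk_eq_zero, ← map_dvd_map _ hA (monic_of_map_eq_prod_X_sub_C _ hA _ _ e), e]
  refine prod_X_sub_C_dvd hy fun σ => ?_
  obtain ⟨α, hα⟩ := htrans σ
  rw [eval_map_algebraMap, ← hα, ← algEquiv_aeval, hx, map_zero]

/-- The algebra `A[Y]/(h)` is normal if `h` is separable over the normal domain `A`: if the element
`z` of its field of fractions is integral, with conjugates `z_σ`, then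
`∑ z_σ ∏_{τ ≠ σ} (Y - y_τ)` has coefficients in `A`, and its value at the root is `z h'`, where `h'`
is a unit. -/
theorem isIntegrallyClosed_adjoinRoot [IsIntegrallyClosed A] [IsFractionRing A E]
    [Normal E Ω] (hy : Function.Injective y) (hs : ∀ σ, IsSeparable E (y σ))
    (e : h.map (algebraMap A Ω) = ∏ σ, (X - C (y σ)))
    (hperm : ∀ β : Ω ≃ₐ[E] Ω, ∃ π : Equiv.Perm G, ∀ σ, β (y σ) = y (π σ)) {σ₀ : G}
    (htrans : ∀ σ, ∃ α : Ω ≃ₐ[E] Ω, α (y σ₀) = y σ) (hcop : IsCoprime h (derivative h)) :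
    IsDomain (AdjoinRoot h) ∧ IsIntegrallyClosed (AdjoinRoot h) := by
  classical
  have hA : Function.Injective (algebraMap A Ω) := by
    rw [IsScalarTower.algebraMap_eq A E Ω]
    exact (algebraMap E Ω).injective.comp (IsFractionRing.injective A E)
  have hφ := rootHom_injective hA hy e htrans
  have hdom : IsDomain (AdjoinRoot h) := hφ.isDomain (rootHom e σ₀).toRingHom
  refine ⟨hdom, (isIntegrallyClosed_iff (FractionRing (AdjoinRoot h))).2 fun {x} hx => ?_⟩
  obtain ⟨b, b', hb', rfl⟩ := IsFractionRing.div_surjective (A := AdjoinRoot h) x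
  let Φ : FractionRing (AdjoinRoot h) →+* Ω :=
    IsFractionRing.lift (g := (rootHom e σ₀).toRingHom) hφ
  have hΦ : ∀ c, Φ (algebraMap _ _ c) = rootHom e σ₀ c := fun c =>
    IsFractionRing.lift_algebraMap hφ c
  obtain ⟨p, rfl⟩ := AdjoinRoot.mk_surjective b
  obtain ⟨p', rfl⟩ := AdjoinRoot.mk_surjective b'
  have hp' : ∀ σ, aeval (y σ) p' ≠ 0 := by
    intro σ h0
    obtain ⟨α, hα⟩ := htrans σ
    rw [← hα, ← algEquiv_aeval, EmbeddingLike.map_eq_zero_iff, ← rootHom_mk e σ₀] at h0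
    exact nonZeroDivisors.ne_zero hb' (hφ (h0.trans (map_zero _).symm))
  let z : G → Ω := fun σ => aeval (y σ) p / aeval (y σ) p'
  have hzβ : ∀ (β : Ω ≃ₐ[E] Ω) (σ τ : G), β (y σ) = y τ → β (z σ) = z τ := fun β σ τ hβ => by
    simp only [z, map_div₀, algEquiv_aeval, hβ]
  have hz₀ : Φ (algebraMap _ _ (AdjoinRoot.mk h p) / algebraMap _ _ (AdjoinRoot.mk h p')) =
      z σ₀ := by
    rw [map_div₀, hΦ, hΦ, rootHom_mk, rootHom_mk]
  have hyi : ∀ σ, IsIntegral A (y σ) := fun σ =>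
    ⟨h, monic_of_map_eq_prod_X_sub_C _ hA _ _ e, aeval_eq_zero_of_map_eq_prod e⟩
  have hzi₀ : IsIntegral A (z σ₀) := by
    have : Algebra.IsIntegral A (AdjoinRoot h) :=
      have := (monic_of_map_eq_prod_X_sub_C _ hA _ _ e).finite_adjoinRoot
      inferInstance
    have h1 : IsIntegral A (algebraMap _ (FractionRing (AdjoinRoot h)) (AdjoinRoot.mk h p) /
      algebraMap _ _ (AdjoinRoot.mk h p')) := isIntegral_trans _ hx
    rw [← hz₀]
    obtain ⟨P, hP, hP0⟩ := h1
    refine ⟨P, hP, ?_⟩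
    have h2 := congrArg Φ hP0
    rw [hom_eval₂, map_zero] at h2
    have hcomp : Φ.comp (algebraMap A (FractionRing (AdjoinRoot h))) = algebraMap A Ω :=
      RingHom.ext fun a => by
        rw [RingHom.comp_apply, IsScalarTower.algebraMap_apply A (AdjoinRoot h) (FractionRing _),
          hΦ, AlgHom.commutes]
    rwa [hcomp] at h2
  have hzi : ∀ σ, IsIntegral A (z σ) := fun σ => by
    obtain ⟨α, hα⟩ := htrans σ
    rw [← hzβ α _ _ hα]
    exact hzi₀.map ((α : Ω →ₐ[E] Ω).restrictScalars A)
  have hzs : ∀ σ, z σ ∈ separableClosure E Ω := fun σ => by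
    have h1 : ∀ q : A[X], aeval (y σ) q ∈ separableClosure E Ω := fun q => by
      rw [← aeval_map_algebraMap E]
      exact (aeval_mem_adjoin_singleton E (y σ)) |> fun hm =>
        (Algebra.adjoin_le (S := (separableClosure E Ω).toSubalgebra)
          (Set.singleton_subset_iff.2 (mem_separableClosure_iff.2 (hs σ)))) hm
    exact div_mem (h1 p) (h1 p')
  let q : Polynomial Ω := ∑ σ, C (z σ) * ∏ τ ∈ Finset.univ.erase σ, (X - C (y τ))
  have hmem : ∀ S : Subring Ω, (∀ σ, z σ ∈ S) → (∀ σ, y σ ∈ S) → ∀ k, q.coeff k ∈ S := by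
    intro S h1 h2 k
    simp only [q, finsetSum_coeff, coeff_C_mul]
    exact S.sum_mem fun σ _ => S.mul_mem (h1 σ)
      (coeff_prod_X_sub_C_mem S _ y (fun τ _ => h2 τ) k)
  obtain ⟨P, hP⟩ : ∃ P : A[X], P.map (algebraMap A Ω) = q := by
    refine exists_map_eq_of_coeff_fixed (E := E) (fun k => ?_) (fun k => ?_) fun β => ?_
    · exact mem_separableClosure_iff.1 (hmem (separableClosure E Ω).toSubring hzs
        (fun σ => mem_separableClosure_iff.2 (hs σ)) k)
    · exact hmem (integralClosure A Ω).toSubring hzi hyi k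
    · obtain ⟨π, hπ⟩ := hperm β
      simp only [q, Polynomial.map_sum, Polynomial.map_mul, map_C, map_prod_X_sub_C,
        RingHom.coe_coe, hπ, hzβ β _ _ (hπ _)]
      conv_rhs => rw [← Equiv.sum_comp π]
      refine Finset.sum_congr rfl fun σ _ => ?_
      congr 1
      refine Finset.prod_equiv π (fun i => ?_) fun _ _ => rfl
      simp
  have hq : q.eval (y σ₀) = z σ₀ * aeval (y σ₀) (derivative h) := by
    rw [← eval_map_algebraMap, ← derivative_map, e]
    change _ = _ * eval (y σ₀) (derivative (Lagrange.nodal Finset.univ y))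
    rw [Lagrange.eval_nodal_derivative_eval_node_eq (Finset.mem_univ σ₀), Lagrange.nodal]
    simp only [q, eval_finsetSum, eval_mul, eval_C]
    refine Finset.sum_eq_single σ₀ (fun σ _ hσ => ?_) (fun h => absurd (Finset.mem_univ _) h)
    rw [eval_prod, Finset.prod_eq_zero (i := σ₀), mul_zero]
    · simpa using hσ.symm
    · simp
  obtain ⟨a, c, hac⟩ := hcop
  have hc : aeval (y σ₀) (derivative h) * aeval (y σ₀) c = 1 := by
    have := congrArg (aeval (y σ₀)) hac
    simpa [aeval_eq_zero_of_map_eq_prod e, mul_comm] using this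
  refine ⟨AdjoinRoot.mk h (P * c), Φ.injective ?_⟩
  rw [hΦ, rootHom_mk, hz₀, map_mul, ← eval_map_algebraMap P, hP, hq, mul_assoc, hc, mul_one]

/-- This is a standard étale algebra in which nothing has to be inverted. -/
theorem etale_adjoinRoot (hm : h.Monic) (hcop : IsCoprime h (derivative h)) :
    Algebra.Etale A (AdjoinRoot h) := by
  obtain ⟨a, c, hac⟩ := hcop
  let P : StandardEtalePair A := ⟨h, hm, 1, c, a, 0, by rw [pow_zero, ← hac]; ring⟩
  have hu : IsUnit (AdjoinRoot.mk P.f P.g) := by simp [P]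
  exact Algebra.Etale.of_equiv (P.equivAwayAdjoinRoot.trans
    ((IsLocalization.atUnit (AdjoinRoot h) (Localization.Away (AdjoinRoot.mk P.f P.g)) _
      hu).restrictScalars A).symm)

/-- The algebra `A[Y]/(h)` remains a domain after the algebraic extension `Kb` of the field of
constants `K`, provided that the conjugates of a root are permuted transitively by automorphisms
fixing given constants: then `Kb` and the subfield generated by the root are linearly disjoint. -/
theorem isDomain_tensorProduct_adjoinRoot {K Kb : Type*} [Field K] [Field Kb] [Algebra K Kb]
    [Algebra.IsAlgebraic K Kb] [Algebra K A] [Algebra K Ω] [Algebra Kb Ω] [IsScalarTower K Kb Ω]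
    [IsScalarTower K A Ω] (hA : Function.Injective (algebraMap A Ω)) (hy : Function.Injective y)
    (e : h.map (algebraMap A Ω) = ∏ σ, (X - C (y σ))) {σ₀ : G}
    (htrans : ∀ S : Finset Ω, (∀ s ∈ S, IsIntegral K s) → ∀ σ, ∃ α : Ω ≃ₐ[E] Ω,
      α (y σ₀) = y σ ∧ ∀ s ∈ S, α s = s)
    {ι : Type*} (b : Module.Basis ι K Kb)
    (hind : LinearIndependent A fun j => algebraMap Kb Ω (b j)) :
    IsDomain (Kb ⊗[K] AdjoinRoot h) := by
  classical
  have hnt : Nontrivial A := (algebraMap A Ω).domain_nontrivial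
  have hφ : Function.Injective (rootHom e σ₀) := rootHom_injective (E := E) hA hy e fun σ => by
    obtain ⟨α, hα, -⟩ := htrans ∅ (by simp) σ
    exact ⟨α, hα⟩
  have hm := monic_of_map_eq_prod_X_sub_C _ hA _ _ e
  let fa : Kb →ₐ[K] Ω := IsScalarTower.toAlgHom K Kb Ω
  let fb : AdjoinRoot h →ₐ[K] Ω := (rootHom e σ₀).restrictScalars K
  have hfa : Function.Injective fa := (algebraMap Kb Ω).injective
  refine Subalgebra.LinearDisjoint.isDomain_of_injective (fa := fa) (fb := fb) hfa hφ ?_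
  let b' := b.map (AlgEquiv.ofInjective fa hfa).toLinearEquiv
  refine Subalgebra.LinearDisjoint.of_basis_left _ _ b' ?_
  have hb' : ∀ j, (fa.range.val ∘ b') j = algebraMap Kb Ω (b j) := fun j => rfl
  rw [linearIndependent_iff']
  intro s c hc j₀ hj₀
  have hcp : ∀ j, ∃ p : A[X], p.degree < h.degree ∧ aeval (y σ₀) p = (c j : Ω) := by
    intro j
    obtain ⟨x, hx⟩ := (c j).2
    obtain ⟨p, rfl⟩ := AdjoinRoot.mk_surjective x
    refine ⟨p %ₘ h, degree_modByMonic_lt _ hm, ?_⟩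
    rw [← hx]
    change _ = rootHom e σ₀ _
    rw [rootHom_mk]
    conv_rhs => rw [← modByMonic_add_div p h]
    rw [map_add, map_mul, aeval_eq_zero_of_map_eq_prod e, zero_mul, add_zero]
  choose p hpd hp using hcp
  -- A relation between the constants `b j` over the algebra is the vanishing at `y σ₀` of a
  -- polynomial of smaller degree than `h`; by transitivity it vanishes at all roots of `h`.
  let P : Polynomial Ω := ∑ j ∈ s, C (algebraMap Kb Ω (b j)) * (p j).map (algebraMap A Ω)
  have hP0 : P = 0 := by
    by_contra hne
    have hroot : ∀ σ, P.eval (y σ) = 0 := by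
      intro σ
      obtain ⟨α, hα, hfix⟩ := htrans (s.image fun j => algebraMap Kb Ω (b j)) (by
        intro x hx
        obtain ⟨j, -, rfl⟩ := Finset.mem_image.1 hx
        exact (Algebra.IsIntegral.isIntegral (b j)).map fa) σ
      have h1 : ∑ j ∈ s, (aeval (y σ₀) (p j)) * algebraMap Kb Ω (b j) = 0 := by
        rw [← hc]
        refine Finset.sum_congr rfl fun j _ => ?_
        rw [hp, Algebra.smul_def, hb']; rfl
      have h2 := congrArg α h1
      simp only [map_sum, map_mul, map_zero, algEquiv_aeval, hα] at h2
      rw [← h2]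
      simp only [P, eval_finsetSum, eval_mul, eval_C, eval_map_algebraMap]
      refine Finset.sum_congr rfl fun j hj => ?_
      rw [hfix _ (Finset.mem_image_of_mem _ hj), mul_comm]
    have hdvd := prod_X_sub_C_dvd hy hroot
    rw [← e] at hdvd
    have hle := degree_le_of_dvd hdvd hne
    rw [degree_map_eq_of_injective hA] at hle
    have hlt : P.degree < h.degree := by
      refine (degree_sum_le _ _).trans_lt ((Finset.sup_lt_iff ?_).2 fun j _ => ?_)
      · exact bot_lt_iff_ne_bot.2 fun h0 => hm.ne_zero (degree_eq_bot.1 h0)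
      · have hbj : algebraMap Kb Ω (b j) ≠ 0 := by simpa using b.ne_zero j
        rw [degree_C_mul hbj, degree_map_eq_of_injective hA]; exact hpd j
    exact absurd hle (not_le.2 hlt)
  have hpz : p j₀ = 0 := by
    ext k
    have h1 := congrArg (fun q => coeff q k) hP0
    simp only [P, finsetSum_coeff, coeff_C_mul, coeff_map, coeff_zero] at h1
    rw [linearIndependent_iff'] at hind
    refine hind s (fun j => (p j).coeff k) ?_ j₀ hj₀
    rw [← h1]
    refine Finset.sum_congr rfl fun j _ => ?_
    rw [Algebra.smul_def, mul_comm]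
  apply Subtype.ext
  rw [← hp, hpz, map_zero]; rfl

/-- Constants that are linearly independent over `K` stay so over `K[A]`, as the variables are
algebraically independent over every algebraic extension of `K`. -/
theorem linearIndependent_mvPolynomial {σ K Kb Ω : Type*} [Field K] [Field Kb] [Field Ω]
    [Algebra K Kb] [Algebra.IsAlgebraic K Kb] [Algebra K Ω] [Algebra Kb Ω] [IsScalarTower K Kb Ω]
    [Algebra (MvPolynomial σ K) Ω] [IsScalarTower K (MvPolynomial σ K) Ω]
    (hinj : Function.Injective (algebraMap (MvPolynomial σ K) Ω)) {ι : Type*} {b : ι → Kb}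
    (hb : LinearIndependent K b) :
    LinearIndependent (MvPolynomial σ K) fun j => algebraMap Kb Ω (b j) := by
  let x : σ → Ω := fun i => algebraMap (MvPolynomial σ K) Ω (MvPolynomial.X i)
  have hx : MvPolynomial.aeval (R := K) x = IsScalarTower.toAlgHom K (MvPolynomial σ K) Ω := by
    ext i; simp [x]
  have hK : AlgebraicIndependent K x := by
    rw [AlgebraicIndependent, hx]; exact hinj
  have hKb : AlgebraicIndependent Kb x := hK.extendScalars Kb
  rw [linearIndependent_iff']
  intro s r hr j hj
  let q : MvPolynomial σ Kb := ∑ j ∈ s, MvPolynomial.C (b j) * (r j).map (algebraMap K Kb)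
  have hq : MvPolynomial.aeval x q = 0 := by
    rw [← hr]
    simp only [q, map_sum, map_mul, MvPolynomial.aeval_map_algebraMap, hx, Algebra.smul_def,
      MvPolynomial.aeval_C]
    exact Finset.sum_congr rfl fun _ _ => mul_comm _ _
  have hq0 : q = 0 := hKb (hq.trans (map_zero _).symm)
  ext m
  have h1 := congrArg (MvPolynomial.coeff m) hq0
  simp only [q, MvPolynomial.coeff_sum, MvPolynomial.coeff_C_mul, MvPolynomial.coeff_map,
    MvPolynomial.coeff_zero] at h1
  rw [linearIndependent_iff'] at hb
  refine hb s (fun j => (r j).coeff m) ?_ j hj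
  rw [← h1]
  exact Finset.sum_congr rfl fun _ _ => by rw [Algebra.smul_def, mul_comm]

end EtaleAlgebra

/-! ### Twisted sums of roots and tuples of generators -/

section TwistedSum

/-- The sum `∑ μ_i(s) τ_i(σ_i(s))`, where `i` runs over `J` and `s` over `H i`. Here `τ_i` will
enumerate the roots of a polynomial by the Galois group `H i` of an extension `L_i`, and `μ_i` the
conjugates of an element of `L_i`. -/
def twistedSum {J Ω : Type*} {H : J → Type*} [CommRing Ω] [Fintype J] [∀ i, Fintype (H i)]
    (μ τ : ∀ i, H i → Ω) (σ : ∀ i, Equiv.Perm (H i)) : Ω :=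
  ∑ i, ∑ s, μ i s * τ i (σ i s)

theorem map_twistedSum {J Ω Ω' : Type*} {H : J → Type*} [CommRing Ω] [CommRing Ω'] [Fintype J]
    [∀ i, Fintype (H i)] (ψ : Ω →+* Ω') (μ τ : ∀ i, H i → Ω) (σ : ∀ i, Equiv.Perm (H i)) :
    ψ (twistedSum μ τ σ) = twistedSum (fun i s => ψ (μ i s)) (fun i s => ψ (τ i s)) σ := by
  simp [twistedSum]

variable {J Ω : Type*} {H : J → Type*} [CommRing Ω] [Fintype J] [∀ i, Fintype (H i)]
  {μ τ : ∀ i, H i → Ω}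

/-- A substitution that permutes the roots by `π` and the coefficients by `b` acts on the index of
a twisted sum by the twisted conjugation `σ ↦ π σ b⁻¹`. -/
theorem twistedSum_eq_of_perm {μ' τ' : ∀ i, H i → Ω} (b π : ∀ i, Equiv.Perm (H i))
    (hμ : ∀ i s, μ' i s = μ i (b i s)) (hτ : ∀ i s, τ' i s = τ i (π i s))
    (σ : ∀ i, Equiv.Perm (H i)) :
    twistedSum μ' τ' σ = twistedSum μ τ (π * σ * b⁻¹) := by
  unfold twistedSum
  refine Finset.sum_congr rfl fun i _ => ?_
  rw [← Equiv.sum_comp (b i) fun s => μ i s * τ i ((π * σ * b⁻¹) i s)]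
  exact Finset.sum_congr rfl fun s _ => by simp [hμ, hτ]

theorem injective_of_twistedSum_injective (hy : Function.Injective (twistedSum μ τ)) (i : J) :
    Function.Injective (τ i) := by
  classical
  intro s s' e
  by_contra hne
  let σ : ∀ i, Equiv.Perm (H i) := Function.update 1 i (Equiv.swap s s')
  have h : twistedSum μ τ σ = twistedSum μ τ 1 := by
    refine Finset.sum_congr rfl fun k _ => Finset.sum_congr rfl fun t _ => ?_
    congr 1
    by_cases hk : k = i
    · subst hk
      simp only [σ, Function.update_self, Pi.one_apply, Equiv.Perm.one_apply]
      rcases eq_or_ne t s with rfl | h1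
      · rw [Equiv.swap_apply_left, e]
      rcases eq_or_ne t s' with rfl | h2
      · rw [Equiv.swap_apply_right, e]
      rw [Equiv.swap_apply_of_ne_of_ne h1 h2]
    · simp [σ, hk]
  have h1 := congrFun (hy h) i
  simp only [σ, Function.update_self, Pi.one_apply] at h1
  exact hne (Equiv.swap_eq_one_iff.1 h1)

end TwistedSum

section Generators

variable {K L : Type*} [Field K] [Field L] [Algebra K L] [FiniteDimensional K L] [IsGalois K L]

theorem adjoin_simple_eq_top_iff_injective {x : L} :
    K⟮x⟯ = ⊤ ↔ Function.Injective fun s : L ≃ₐ[K] L => s x := by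
  constructor
  · intro h s s' e
    have h1 : (s'⁻¹ * s) ∈ K⟮x⟯.fixingSubgroup := by
      rw [IntermediateField.mem_fixingSubgroup_iff]
      have h2 : K⟮x⟯ ≤ fixedField (Subgroup.zpowers (s'⁻¹ * s)) := by
        rw [adjoin_simple_le_iff, mem_fixedField_iff]
        rintro f ⟨k, rfl⟩
        have h3 : s'⁻¹ * s ∈ MulAction.stabilizer (L ≃ₐ[K] L) x := by
          rw [MulAction.mem_stabilizer_iff]
          change s'⁻¹ (s x) = x
          rw [show s x = s' x from e]
          exact s'.symm_apply_apply x
        exact (Subgroup.zpow_mem _ h3 k)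
      intro z hz
      exact (mem_fixedField_iff _ _).1 (h2 hz) _ (Subgroup.mem_zpowers _)
    rw [h, IntermediateField.fixingSubgroup_top, Subgroup.mem_bot] at h1
    exact (inv_mul_eq_one.1 h1).symm
  · intro h
    have h1 : K⟮x⟯.fixingSubgroup = ⊥ := by
      rw [eq_bot_iff]
      intro s hs
      rw [Subgroup.mem_bot]
      apply h
      exact (IntermediateField.mem_fixingSubgroup_iff _ _).1 hs x (mem_adjoin_simple_self K x)
    rw [← IsGalois.fixedField_fixingSubgroup K⟮x⟯, h1, fixedField_bot]

variable {M : Type*} [Field M] [Algebra K M]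

/-- The conjugates of a generator of `L` that is a root of a polynomial with `[L : K]` roots are all
roots of this polynomial, and they all generate `L`. -/
theorem card_generating_roots (j : L →ₐ[K] M) {q : K[X]} {τ : (L ≃ₐ[K] L) → M}
    (hτ : ∀ x, aeval x q = 0 ↔ ∃ s, τ s = x) {x₀ : L} (h₀ : aeval x₀ q = 0) (h₁ : K⟮x₀⟯ = ⊤) :
    Nat.card {x : L // aeval x q = 0 ∧ K⟮x⟯ = ⊤} = Module.finrank K L := by
  classical
  rw [adjoin_simple_eq_top_iff_injective] at h₁
  rw [← IsGalois.card_aut_eq_finrank]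
  have hroot : ∀ s : L ≃ₐ[K] L, aeval (s x₀) q = 0 := fun s => by
    rw [aeval_algEquiv, AlgHom.comp_apply, h₀]; exact map_zero _
  have hj : ∀ x : L, aeval x q = 0 → ∃ s, τ s = j x := fun x hx => by
    rw [← hτ, aeval_algHom_apply, hx, map_zero]
  choose f hf using fun s => hj _ (hroot s)
  have hfi : Function.Injective f := fun s s' e => by
    apply h₁
    apply j.toRingHom.injective
    change j _ = j _
    rw [← hf, ← hf, e]
  have hfs := Finite.injective_iff_surjective.1 hfi
  refine (Nat.card_congr (Equiv.ofBijective (fun s : L ≃ₐ[K] L =>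
    (⟨s x₀, hroot s, ?_⟩ : {x : L // aeval x q = 0 ∧ K⟮x⟯ = ⊤})) ⟨?_, ?_⟩)).symm
  · rw [adjoin_simple_eq_top_iff_injective]
    intro t t' e
    exact mul_right_cancel (h₁ (show (t * s) x₀ = (t' * s) x₀ from e))
  · intro s s' e
    exact h₁ (congrArg Subtype.val e)
  · rintro ⟨x, hx, -⟩
    obtain ⟨t, ht⟩ := hj x hx
    obtain ⟨s, rfl⟩ := hfs t
    refine ⟨s, Subtype.ext (j.toRingHom.injective ?_)⟩
    exact (hf s).symm.trans ht

end Generators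

section Points

theorem aeval_eq_zero_iff_of_map_eq_prod {K M G : Type*} [Field K] [Field M] [Algebra K M]
    [Fintype G] {y : G → M} {h : K[X]}
    (e : h.map (algebraMap K M) = ∏ σ, (X - C (y σ))) {x : M} :
    aeval x h = 0 ↔ ∃ σ, y σ = x := by
  rw [← eval_map_algebraMap, e, eval_prod, Finset.prod_eq_zero_iff]
  simp [sub_eq_zero, eq_comm]

variable {K M J : Type*} [Field K] [Field M] [Algebra K M] [Normal K M] [Fintype J]
  {L : J → Type*} [∀ i, Field (L i)] [∀ i, Algebra K (L i)] [∀ i, FiniteDimensional K (L i)]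
  [∀ i, IsGalois K (L i)] {j : ∀ i, L i →ₐ[K] M} {q : J → K[X]}
  [Fintype (∀ i, Equiv.Perm (L i ≃ₐ[K] L i))] {τ : ∀ i, (L i ≃ₐ[K] L i) → M}
  {m : ∀ i, L i} {h : K[X]}

/-- The rational roots of the polynomial with roots the twisted sums correspond to the tuples of
generators `x_i` of `L_i` that are roots of `q_i`, by `x ↦ ∑ Tr(m_i x_i)`. A twisted sum indexed by
`σ` is rational if and only if each `σ_i` intertwines the action of the absolute Galois group on the
roots of `q_i` with its action on `Gal(L_i/K)` by translations. -/
theorem bijOn_trace_roots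
    (hq : ∀ i, (q i).map (algebraMap K M) = ∏ s, (X - C (τ i s)))
    (hy : Function.Injective (twistedSum (fun i s => j i (s (m i))) τ))
    (hh : h.map (algebraMap K M) =
      ∏ σ, (X - C (twistedSum (fun i s => j i (s (m i))) τ σ))) :
    Set.BijOn (fun x : ∀ i, L i => ∑ i, Algebra.trace K (L i) (m i * x i))
      {x | ∀ i, aeval (x i) (q i) = 0 ∧ K⟮x i⟯ = ⊤} {η | h.eval η = 0} := by
  classical
  have hτ : ∀ i x, aeval x (q i) = 0 ↔ ∃ s, τ i s = x := fun i x =>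
    aeval_eq_zero_iff_of_map_eq_prod (hq i)
  have hτi := injective_of_twistedSum_injective hy
  have hroot : ∀ η : K, h.eval η = 0 ↔
      ∃ σ, twistedSum (fun i s => j i (s (m i))) τ σ = algebraMap K M η := fun η => by
    rw [← aeval_eq_zero_iff_of_map_eq_prod hh, aeval_algebraMap_apply,
      map_eq_zero_iff _ (algebraMap K M).injective, coe_aeval_eq_eval]
  have htr : ∀ (x : ∀ i, L i) (σ : ∀ i, Equiv.Perm (L i ≃ₐ[K] L i)),
      (∀ i s, τ i (σ i s) = j i (s (x i))) →
      twistedSum (fun i s => j i (s (m i))) τ σ =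
        algebraMap K M (∑ i, Algebra.trace K (L i) (m i * x i)) := by
    intro x σ hσ
    rw [map_sum]
    refine Finset.sum_congr rfl fun i _ => ?_
    rw [← (j i).commutes, trace_eq_sum_automorphisms, map_sum]
    exact Finset.sum_congr rfl fun s _ => by rw [hσ, map_mul, map_mul]
  have hgen : ∀ x : ∀ i, L i, (∀ i, aeval (x i) (q i) = 0 ∧ K⟮x i⟯ = ⊤) →
      ∃ σ : ∀ i, Equiv.Perm (L i ≃ₐ[K] L i), ∀ i s, τ i (σ i s) = j i (s (x i)) := by
    intro x hx
    have h1 : ∀ i (s : L i ≃ₐ[K] L i), ∃ s', τ i s' = j i (s (x i)) := fun i s => by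
      rw [← hτ, aeval_algHom_apply, aeval_algEquiv, AlgHom.comp_apply, (hx i).1]
      simp
    choose f hf using h1
    have hfi : ∀ i, Function.Injective (f i) := fun i s s' e => by
      apply adjoin_simple_eq_top_iff_injective.1 (hx i).2
      apply (j i).toRingHom.injective
      change j i _ = j i _
      rw [← hf, ← hf, e]
    exact ⟨fun i => Equiv.ofBijective (f i) (Finite.injective_iff_bijective.1 (hfi i)), hf⟩
  refine ⟨fun x hx => ?_, fun x hx x' hx' e => ?_, fun η hη => ?_⟩
  · obtain ⟨σ, hσ⟩ := hgen x hx
    exact (hroot _).2 ⟨σ, htr x σ hσ⟩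
  · obtain ⟨σ, hσ⟩ := hgen x hx
    obtain ⟨σ', hσ'⟩ := hgen x' hx'
    have h1 : σ = σ' := hy (by rw [htr x σ hσ, htr x' σ' hσ']; exact congrArg _ e)
    subst h1
    funext i
    apply (j i).toRingHom.injective
    exact (hσ i 1).symm.trans (hσ' i 1)
  · obtain ⟨σ, hσ⟩ := (hroot η).1 hη
    -- As `η` is rational, an automorphism of `M` fixes the twisted sum with index `σ`, hence also
    -- the index `σ`; so it acts on the roots `τ i (σ i s)` by a translation of `s`.
    have key : ∀ β : M ≃ₐ[K] M, ∀ i, ∃ b : L i ≃ₐ[K] L i, (∀ x, β (j i x) = j i (b x)) ∧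
        ∀ s, β (τ i (σ i s)) = τ i (σ i (b * s)) := by
      intro β
      choose b hb using fun i => exists_restrict_of_normal (j i) β
      choose π hπ using fun i => exists_perm_of_algEquiv (hτi i) (hτ i) β
      have h1 : twistedSum (fun i s => j i (s (m i))) τ
          (π * σ * (fun i => Equiv.mulLeft (b i))⁻¹) =
          twistedSum (fun i s => j i (s (m i))) τ σ := by
        rw [← twistedSum_eq_of_perm (fun i => Equiv.mulLeft (b i)) π
          (μ' := fun i s => β (j i (s (m i)))) (τ' := fun i s => β (τ i s))
          (fun i s => hb i _) hπ σ]
        have h2 := map_twistedSum (β : M →+* M) (fun i s => j i (s (m i))) τ σ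
        simp only [RingHom.coe_coe] at h2
        rw [← h2, hσ, AlgEquiv.commutes]
      have h2 : π * σ = σ * (fun i => Equiv.mulLeft (b i)) := by
        rw [← mul_inv_eq_iff_eq_mul]; exact hy h1
      intro i
      refine ⟨b i, hb i, fun s => ?_⟩
      rw [hπ]
      exact congrArg (τ i) (congrArg (fun p => p s) (congrFun h2 i))
    have hsep : ∀ i, (q i).Separable := fun i => by
      rw [← separable_map (algebraMap K M), hq]
      exact separable_prod_X_sub_C_iff.2 (hτi i)
    have hx : ∀ i, ∃ x : L i, j i x = τ i (σ i 1) := by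
      intro i
      let : Algebra (L i) M := (j i).toRingHom.toAlgebra
      have : IsScalarTower K (L i) M :=
        IsScalarTower.of_algebraMap_eq fun x => ((j i).commutes x).symm
      have : Normal (L i) M := Normal.tower_top_of_normal K (L i) M
      refine mem_range_algebraMap_of_fixed (E := L i) ?_ fun β => ?_
      · have h1 : IsSeparable K (τ i (σ i 1)) :=
          (hsep i).of_dvd (minpoly.dvd _ _ ((hτ i _).2 ⟨_, rfl⟩))
        exact h1.tower_top (L i)
      · obtain ⟨b, hb, hbσ⟩ := key (β.restrictScalars K) i
        have hb1 : b = 1 := by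
          ext x
          apply (j i).toRingHom.injective
          exact (hb x).symm.trans (β.commutes x)
        have := hbσ 1
        rwa [hb1, one_mul] at this
    choose x hx using hx
    have hx' : ∀ i s, τ i (σ i s) = j i (s (x i)) := by
      intro i s
      let : Algebra (L i) M := (j i).toRingHom.toAlgebra
      have : IsScalarTower K (L i) M :=
        IsScalarTower.of_algebraMap_eq fun x => ((j i).commutes x).symm
      obtain ⟨b, hb, hbσ⟩ := key (s.liftNormal M) i
      have hbs : b = s := by
        ext x
        apply (j i).toRingHom.injective
        exact (hb x).symm.trans (s.liftNormal_commutes M x)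
      have h1 := hbσ 1
      rw [hbs, mul_one, ← hx] at h1
      rw [← h1]
      exact s.liftNormal_commutes M (x i)
    refine ⟨x, fun i => ⟨?_, ?_⟩, ?_⟩
    · apply (j i).toRingHom.injective
      change j i _ = j i _
      rw [← aeval_algHom_apply, map_zero, hx, hτ]
      exact ⟨_, rfl⟩
    · rw [adjoin_simple_eq_top_iff_injective]
      intro s s' e
      apply (σ i).injective
      apply hτi i
      rw [hx', hx', show s (x i) = s' (x i) from e]
    · apply (algebraMap K M).injective
      rw [← hσ]
      exact (htr x σ hx').symm

/-- Each `L_i` contains `[L_i : K]` generators that are roots of `q_i`, if it contains one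
at all. -/
theorem ncard_roots_of_generatedByRoot
    (hq : ∀ i, (q i).map (algebraMap K M) = ∏ s, (X - C (τ i s)))
    (hy : Function.Injective (twistedSum (fun i s => j i (s (m i))) τ))
    (hh : h.map (algebraMap K M) =
      ∏ σ, (X - C (twistedSum (fun i s => j i (s (m i))) τ σ))) :
    ((∃ η, h.eval η = 0) ↔ ∀ i, GeneratedByRoot (L i) (q i)) ∧
    ((∃ η, h.eval η = 0) → {η | h.eval η = 0}.ncard = ∏ i, Module.finrank K (L i)) := by
  have hb := bijOn_trace_roots hq hy hh
  have h1 : (∃ η, h.eval η = 0) ↔ ∀ i, GeneratedByRoot (L i) (q i) := by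
    constructor
    · rintro ⟨η, hη⟩ i
      obtain ⟨x, hx, -⟩ := hb.surjOn hη
      exact ⟨x i, hx i⟩
    · intro hg
      choose x hx using hg
      exact ⟨_, hb.mapsTo (show x ∈ {x | _} from hx)⟩
  refine ⟨h1, fun hη => ?_⟩
  have hg := h1.1 hη
  rw [← hb.image_eq, hb.injOn.ncard_image, ← Nat.card_coe_set_eq]
  have e : {x : ∀ i, L i | ∀ i, aeval (x i) (q i) = 0 ∧ K⟮x i⟯ = ⊤} ≃
      ∀ i, {x : L i // aeval x (q i) = 0 ∧ K⟮x⟯ = ⊤} :=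
    Equiv.subtypePiEquivPi (p := fun i x => aeval x (q i) = 0 ∧ K⟮x⟯ = ⊤)
  rw [Nat.card_congr e, Nat.card_pi]
  refine Finset.prod_congr rfl fun i _ => ?_
  obtain ⟨x, hx, hx'⟩ := hg i
  exact card_generating_roots (j i) (fun x => aeval_eq_zero_iff_of_map_eq_prod (hq i)) hx hx'

end Points

/-! ### Specialization of integral elements -/

/-- A rational point of `Spec R` lifts to a geometric point of the spectrum of an integral
extension. -/
theorem exists_ringHom_of_isIntegral {K R O M : Type*} [Field K] [CommRing R] [CommRing O]
    [Field M] [IsAlgClosed M] [Algebra K R] [Algebra K M] [Algebra R O] [Algebra.IsIntegral R O]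
    (hinj : Function.Injective (algebraMap R O)) (ev : R →ₐ[K] K) :
    ∃ ψ : O →+* M, ∀ r, ψ (algebraMap R O r) = algebraMap K M (ev r) := by
  have hev : Function.Surjective (ev : R →+* K) := fun k => ⟨algebraMap K R k, ev.commutes k⟩
  have hP : (RingHom.ker (ev : R →+* K)).IsMaximal := RingHom.ker_isMaximal_of_surjective _ hev
  obtain ⟨Q, hQ, hQP⟩ := Ideal.exists_ideal_over_maximal_of_isIntegral (S := O)
    (RingHom.ker (ev : R →+* K)) (by
      rw [(RingHom.injective_iff_ker_eq_bot (algebraMap R O)).1 hinj]; exact bot_le)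
  let : Field (O ⧸ Q) := Ideal.Quotient.field Q
  let k : K →+* O ⧸ Q := ((Ideal.Quotient.mk Q).comp (algebraMap R O)).comp (algebraMap K R)
  have hk : k.comp (ev : R →+* K) = (Ideal.Quotient.mk Q).comp (algebraMap R O) := by
    ext r
    have h1 : algebraMap K R (ev r) - r ∈ RingHom.ker (ev : R →+* K) := by
      rw [RingHom.mem_ker]
      simp
    rw [← hQP, Ideal.mem_comap, map_sub] at h1
    exact Ideal.Quotient.eq.2 h1
  let : Algebra K (O ⧸ Q) := k.toAlgebra
  have hint : Algebra.IsIntegral K (O ⧸ Q) := ⟨fun x => by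
    obtain ⟨x, rfl⟩ := Ideal.Quotient.mk_surjective x
    obtain ⟨p, hp, hp0⟩ := Algebra.IsIntegral.isIntegral (R := R) x
    refine ⟨p.map (ev : R →+* K), hp.map _, ?_⟩
    change eval₂ k _ _ = 0
    rw [eval₂_map, hk, ← hom_eval₂, hp0, map_zero]⟩
  let f : (O ⧸ Q) →ₐ[K] M := IsAlgClosed.lift
  refine ⟨(f : (O ⧸ Q) →+* M).comp (Ideal.Quotient.mk Q), fun r => ?_⟩
  have h1 : Ideal.Quotient.mk Q (algebraMap R O r) = k (ev r) :=
    (congrArg (fun g => g r) hk).symm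
  rw [RingHom.comp_apply, h1]
  exact f.commutes (ev r)

/-! ### The closed subvariety of affine space defined by a polynomial over a principal open set -/

section CoordinateRing

variable {K : Type u} [Field K] {n : ℕ}

/-- Polynomials in `A_1, …, A_n`, regarded as polynomials in `n + 3` variables. -/
def baseInclusion (K : Type u) [Field K] (n : ℕ) :
    MvPolynomial (Fin n) K →ₐ[K] MvPolynomial (Fin (n + 3)) K :=
  MvPolynomial.rename (Fin.castAdd 3)

/-- The polynomial `h(A, Y)` in `n + 3` variables, where `Y` is the last variable but one. -/
def rootEquation (h : (MvPolynomial (Fin n) K)[X]) : MvPolynomial (Fin (n + 3)) K :=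
  eval₂ (baseInclusion K n).toRingHom (MvPolynomial.X (Fin.natAdd n 1)) h

/-- The polynomial `g(A) Z - 1` in `n + 3` variables. -/
def inverseEquation (g : MvPolynomial (Fin n) K) : MvPolynomial (Fin (n + 3)) K :=
  baseInclusion K n g * MvPolynomial.X (Fin.natAdd n 0) - 1

open Classical in
/-- The equations `g(A) Z = 1`, `h(A, Y) = 0` and `W = 0` in affine `(n + 3)`-space with
coordinates `A_1, …, A_n, Z, Y, W`. The last coordinate is superfluous. -/
def coverEquations (g : MvPolynomial (Fin n) K) (h : (MvPolynomial (Fin n) K)[X]) :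
    Finset (MvPolynomial (Fin (n + 3)) K) :=
  {inverseEquation g, rootEquation h, MvPolynomial.X (Fin.natAdd n 2)}

/-- The ideal of the closed subvariety `W'` of affine `(n + 3)`-space. -/
def coverIdeal (g : MvPolynomial (Fin n) K) (h : (MvPolynomial (Fin n) K)[X]) :
    Ideal (MvPolynomial (Fin (n + 3)) K) :=
  Ideal.span (coverEquations g h : Set (MvPolynomial (Fin (n + 3)) K))

theorem coe_coverEquations (g : MvPolynomial (Fin n) K) (h : (MvPolynomial (Fin n) K)[X]) :
    (coverEquations g h : Set (MvPolynomial (Fin (n + 3)) K)) =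
      {inverseEquation g, rootEquation h, MvPolynomial.X (Fin.natAdd n 2)} := by
  simp [coverEquations]

theorem totalDegree_sum_coverEquations_le (g : MvPolynomial (Fin n) K)
    (h : (MvPolynomial (Fin n) K)[X]) {m : ℕ} (hm : ∀ k, (h.coeff k).totalDegree ≤ m) :
    ∑ q ∈ coverEquations g h, q.totalDegree ≤ (g.totalDegree + 1) + (m + h.natDegree) + 1 := by
  classical
  have h1 : (inverseEquation g).totalDegree ≤ g.totalDegree + 1 := by
    refine (MvPolynomial.totalDegree_sub _ _).trans (max_le ?_ (by simp))
    refine (MvPolynomial.totalDegree_mul _ _).trans (Nat.add_le_add ?_ ?_)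
    · exact MvPolynomial.totalDegree_rename_le _ _
    · rw [MvPolynomial.totalDegree_X]
  have h2 : (rootEquation h).totalDegree ≤ m + h.natDegree := by
    rw [rootEquation, eval₂_eq_sum_range]
    refine MvPolynomial.totalDegree_finsetSum_le fun k hk => ?_
    refine (MvPolynomial.totalDegree_mul _ _).trans (Nat.add_le_add ?_ ?_)
    · exact (MvPolynomial.totalDegree_rename_le _ _).trans (hm k)
    · rw [MvPolynomial.totalDegree_X_pow]; exact Finset.mem_range_succ_iff.1 hk
  have h3 : (MvPolynomial.X (Fin.natAdd n 2) : MvPolynomial (Fin (n + 3)) K).totalDegree = 1 :=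
    MvPolynomial.totalDegree_X _
  have h4 : ∀ (a : MvPolynomial (Fin (n + 3)) K) (s : Finset (MvPolynomial (Fin (n + 3)) K)),
      ∑ q ∈ insert a s, q.totalDegree ≤ a.totalDegree + ∑ q ∈ s, q.totalDegree := fun a s => by
    by_cases ha : a ∈ s
    · rw [Finset.insert_eq_of_mem ha]; exact Nat.le_add_left _ _
    · rw [Finset.sum_insert ha]
  refine (h4 _ _).trans ?_
  rw [add_assoc]
  refine Nat.add_le_add h1 ((h4 _ _).trans ?_)
  rw [Finset.sum_singleton, h3]
  exact Nat.add_le_add_right h2 1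

/-- The algebra `K[A, g⁻¹][Y]/(h)`. -/
abbrev CoverAlgebra (g : MvPolynomial (Fin n) K) (h : (MvPolynomial (Fin n) K)[X]) : Type u :=
  AdjoinRoot (h.map (algebraMap (MvPolynomial (Fin n) K) (OpenCoordRing g)))

section Equiv

variable (g : MvPolynomial (Fin n) K) (h : (MvPolynomial (Fin n) K)[X])

/-- The point `(A, g⁻¹, Y, 0)` of affine `(n + 3)`-space over the algebra `K[A, g⁻¹][Y]/(h)`. -/
def coverPoint : Fin (n + 3) → CoverAlgebra g h :=
  Fin.append
    (fun j => algebraMap (OpenCoordRing g) (CoverAlgebra g h)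
      (algebraMap (MvPolynomial (Fin n) K) _ (MvPolynomial.X j)))
    ![algebraMap (OpenCoordRing g) (CoverAlgebra g h) (IsLocalization.Away.invSelf g),
      AdjoinRoot.root _, 0]

/-- Evaluation of regular functions on the closed subvariety at the point `coverPoint`. -/
def coordToCover : CoordRing (coverIdeal g h) →ₐ[K] CoverAlgebra g h :=
  Ideal.Quotient.liftₐ _
    (MvPolynomial.aeval (coverPoint g h)) (by
    set φ : MvPolynomial (Fin (n + 3)) K →ₐ[K] CoverAlgebra g h := MvPolynomial.aeval _ with hφ
    have hbase : ∀ r, φ (baseInclusion K n r) = algebraMap (OpenCoordRing g) (CoverAlgebra g h)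
        (algebraMap (MvPolynomial (Fin n) K) _ r) := by
      intro r
      have : φ.comp (baseInclusion K n) = ((IsScalarTower.toAlgHom K (OpenCoordRing g)
          (CoverAlgebra g h)).comp (IsScalarTower.toAlgHom K (MvPolynomial (Fin n) K)
          (OpenCoordRing g))) := by
        ext j
        simp [hφ, coverPoint, baseInclusion]
      exact congrArg (fun f => f r) this
    change coverIdeal g h ≤ RingHom.ker φ
    rw [coverIdeal, Ideal.span_le, coe_coverEquations]
    rintro q (rfl | rfl | rfl)
    · change φ _ = 0
      rw [inverseEquation, map_sub, map_mul, hbase, map_one]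
      have : φ (MvPolynomial.X (Fin.natAdd n 0)) = algebraMap (OpenCoordRing g) (CoverAlgebra g h)
          (IsLocalization.Away.invSelf g) := by simp [hφ, coverPoint]
      rw [this, ← map_mul, IsLocalization.Away.mul_invSelf, map_one, sub_self]
    · change φ.toRingHom _ = 0
      rw [rootEquation, hom_eval₂]
      have h1 : φ.toRingHom (MvPolynomial.X (Fin.natAdd n 1)) = AdjoinRoot.root _ := by
        simp [hφ, coverPoint]
      have h2 : φ.toRingHom.comp (baseInclusion K n).toRingHom =
          (algebraMap (OpenCoordRing g) (CoverAlgebra g h)).comp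
            (algebraMap (MvPolynomial (Fin n) K) _) := RingHom.ext hbase
      rw [h1, h2, ← eval₂_map]
      exact AdjoinRoot.eval₂_root _
    · change φ _ = 0
      simp [hφ, coverPoint])

theorem coordToCover_mk (p : MvPolynomial (Fin (n + 3)) K) :
    coordToCover g h (Ideal.Quotient.mk _ p) = MvPolynomial.aeval (coverPoint g h) p :=
  Ideal.Quotient.lift_mk _ _ _

theorem coordToCover_mk_base (r : MvPolynomial (Fin n) K) :
    coordToCover g h (Ideal.Quotient.mk _ (baseInclusion K n r)) =
      algebraMap (OpenCoordRing g) (CoverAlgebra g h)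
        (algebraMap (MvPolynomial (Fin n) K) _ r) := by
  have : ((coordToCover g h).comp (Ideal.Quotient.mkₐ K _)).comp (baseInclusion K n) =
      ((IsScalarTower.toAlgHom K (OpenCoordRing g)
      (CoverAlgebra g h)).comp (IsScalarTower.toAlgHom K (MvPolynomial (Fin n) K)
      (OpenCoordRing g))) := by
    ext j
    refine (coordToCover_mk g h _).trans ?_
    simp [coverPoint, baseInclusion]
  exact congrArg (fun f => f r) this

theorem coordToCover_mk_inv :
    coordToCover g h (Ideal.Quotient.mk _ (MvPolynomial.X (Fin.natAdd n 0))) =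
      algebraMap (OpenCoordRing g) (CoverAlgebra g h) (IsLocalization.Away.invSelf g) := by
  rw [coordToCover_mk]
  simp [coverPoint]

theorem coordToCover_mk_root :
    coordToCover g h (Ideal.Quotient.mk _ (MvPolynomial.X (Fin.natAdd n 1))) =
      AdjoinRoot.root _ := by
  rw [coordToCover_mk]
  simp [coverPoint]

/-- The map from `K[A]` to the coordinate ring of the closed subvariety. -/
def baseToCoord : MvPolynomial (Fin n) K →+* CoordRing (coverIdeal g h) :=
  (Ideal.Quotient.mk _).comp (baseInclusion K n).toRingHom

theorem baseToCoord_mul_inv :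
    baseToCoord g h g * Ideal.Quotient.mk _ (MvPolynomial.X (Fin.natAdd n 0)) = 1 := by
  have h1 : inverseEquation g ∈ coverIdeal g h :=
    Ideal.subset_span (by rw [coe_coverEquations]; simp)
  exact Ideal.Quotient.eq.2 h1

/-- The extension of `baseToCoord` to `K[A, g⁻¹]`, with `Z` as the value at `g⁻¹`. -/
def openToCoord : OpenCoordRing g →+* CoordRing (coverIdeal g h) :=
  IsLocalization.Away.lift (g := baseToCoord g h) g
    (IsUnit.of_mul_eq_one _ (baseToCoord_mul_inv g h))

theorem openToCoord_algebraMap (r : MvPolynomial (Fin n) K) :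
    openToCoord g h (algebraMap _ _ r) = Ideal.Quotient.mk _ (baseInclusion K n r) :=
  IsLocalization.Away.lift_eq _ _ _

/-- The inverse of `coordToCover`, as a ring homomorphism. -/
def coverToCoord : CoverAlgebra g h →+* CoordRing (coverIdeal g h) :=
  AdjoinRoot.lift (openToCoord g h) (Ideal.Quotient.mk _ (MvPolynomial.X (Fin.natAdd n 1))) (by
    have h1 : rootEquation h ∈ coverIdeal g h :=
      Ideal.subset_span (by rw [coe_coverEquations]; simp)
    have h2 : (openToCoord g h).comp (algebraMap (MvPolynomial (Fin n) K) _) =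
      (Ideal.Quotient.mk _).comp (baseInclusion K n).toRingHom :=
        RingHom.ext (openToCoord_algebraMap g h)
    rw [eval₂_map, h2, ← hom_eval₂]
    exact Ideal.Quotient.eq_zero_iff_mem.2 h1)

theorem coverToCoord_algebraMap (r : OpenCoordRing g) :
    coverToCoord g h (algebraMap _ _ r) = openToCoord g h r :=
  AdjoinRoot.lift_of _

theorem coverToCoord_root : coverToCoord g h (AdjoinRoot.root _) =
    Ideal.Quotient.mk _ (MvPolynomial.X (Fin.natAdd n 1)) :=
  AdjoinRoot.lift_root _

theorem coverToCoord_coordToCover (x : CoordRing (coverIdeal g h)) :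
    coverToCoord g h (coordToCover g h x) = x := by
  have h1 : ((coverToCoord g h).comp
      (coordToCover g h : CoordRing (coverIdeal g h) →+* CoverAlgebra g h)).comp
        (Ideal.Quotient.mk _) =
      Ideal.Quotient.mk _ := by
    have hbase : ∀ r, coverToCoord g h (coordToCover g h
        (Ideal.Quotient.mk _ (baseInclusion K n r))) =
          Ideal.Quotient.mk _ (baseInclusion K n r) := fun r => by
      rw [coordToCover_mk_base, coverToCoord_algebraMap, openToCoord_algebraMap]
    refine MvPolynomial.ringHom_ext (fun k => ?_) fun i => ?_
    · have := hbase (MvPolynomial.C k)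
      rwa [baseInclusion, MvPolynomial.rename_C] at this
    · refine Fin.addCases (fun i => ?_) (fun i => ?_) i
      · have := hbase (MvPolynomial.X i)
        rwa [baseInclusion, MvPolynomial.rename_X] at this
      · change coverToCoord g h (coordToCover g h (Ideal.Quotient.mk _ _)) = _
        fin_cases i
        · rw [show ((fun i => i) ⟨0, by omega⟩ : Fin 3) = 0 from rfl, coordToCover_mk_inv,
            coverToCoord_algebraMap]
          -- both sides are inverse to `g`
          have h2 := congrArg (openToCoord g h) (IsLocalization.Away.mul_invSelf
            (S := OpenCoordRing g) g)
          rw [map_mul, openToCoord_algebraMap, map_one] at h2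
          have h3 := baseToCoord_mul_inv g h
          exact left_inv_eq_right_inv ((mul_comm _ _).trans h2) h3
        · exact (congrArg _ (coordToCover_mk_root g h)).trans (coverToCoord_root g h)
        · have h4 : (Ideal.Quotient.mk (coverIdeal g h)) (MvPolynomial.X (Fin.natAdd n 2)) = 0 :=
            Ideal.Quotient.eq_zero_iff_mem.2
              (Ideal.subset_span (by rw [coe_coverEquations]; simp))
          exact (congrArg (fun z => coverToCoord g h (coordToCover g h z)) h4).trans
            ((by simp : coverToCoord g h (coordToCover g h 0) = 0).trans h4.symm)
  obtain ⟨x, rfl⟩ := Ideal.Quotient.mk_surjective x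
  exact congrArg (fun f => f x) h1

theorem coordToCover_coverToCoord (x : CoverAlgebra g h) :
    coordToCover g h (coverToCoord g h x) = x := by
  have h0 : (coordToCover g h : CoordRing (coverIdeal g h) →+* CoverAlgebra g h).comp
      (openToCoord g h) =
      algebraMap (OpenCoordRing g) (CoverAlgebra g h) := by
    refine IsLocalization.ringHom_ext (Submonoid.powers g) (RingHom.ext fun r => ?_)
    change coordToCover g h (openToCoord g h (algebraMap _ _ r)) = _
    rw [openToCoord_algebraMap, coordToCover_mk_base]; rfl
  obtain ⟨p, rfl⟩ := AdjoinRoot.mk_surjective x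
  have h1 : ((coordToCover g h : CoordRing (coverIdeal g h) →+* CoverAlgebra g h).comp
      (coverToCoord g h)).comp (AdjoinRoot.mk _) =
      AdjoinRoot.mk _ := by
    refine Polynomial.ringHom_ext (fun a => ?_) ?_
    · change coordToCover g h (coverToCoord g h (algebraMap _ _ a)) = _
      rw [coverToCoord_algebraMap]
      exact congrArg (fun f => f a) h0
    · change coordToCover g h (coverToCoord g h (AdjoinRoot.root _)) = _
      rw [coverToCoord_root, coordToCover_mk_root]; rfl
  exact congrArg (fun f => f p) h1

/-- The coordinate ring of the closed subvariety is the algebra `K[A, g⁻¹][Y]/(h)`. -/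
def coordEquivCover : CoordRing (coverIdeal g h) ≃ₐ[K] CoverAlgebra g h :=
  AlgEquiv.ofBijective (coordToCover g h)
    ⟨Function.LeftInverse.injective (coverToCoord_coordToCover g h),
      Function.RightInverse.surjective (coordToCover_coverToCoord g h)⟩

/-- The morphism to the principal open set `g ≠ 0` given by the projection to the first `n`
coordinates. -/
def coverProjection : OpenCoordRing g →ₐ[K] CoordRing (coverIdeal g h) :=
  ((coordEquivCover g h).symm : CoverAlgebra g h →ₐ[K] CoordRing (coverIdeal g h)).comp
    (IsScalarTower.toAlgHom K (OpenCoordRing g) (CoverAlgebra g h))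

theorem coverProjection_algebraMap (r : MvPolynomial (Fin n) K) :
    coverProjection g h (algebraMap _ _ r) = Ideal.Quotient.mk _ (baseInclusion K n r) := by
  change (coordEquivCover g h).symm _ = _
  rw [AlgEquiv.symm_apply_eq]
  exact (coordToCover_mk_base g h r).symm

theorem coverProjection_finite (hm : h.Monic) : (coverProjection g h).toRingHom.Finite := by
  have h1 : Module.Finite (OpenCoordRing g) (CoverAlgebra g h) := (hm.map _).finite_adjoinRoot
  have h2 : (algebraMap (OpenCoordRing g) (CoverAlgebra g h)).Finite :=
    RingHom.finite_algebraMap.2 h1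
  exact (RingHom.Finite.of_surjective _ (coordEquivCover g h).symm.surjective).comp h2

theorem coverProjection_etale (het : Algebra.Etale (OpenCoordRing g) (CoverAlgebra g h)) :
    (coverProjection g h).toRingHom.Etale := by
  have h2 : (algebraMap (OpenCoordRing g) (CoverAlgebra g h)).Etale :=
    RingHom.etale_algebraMap.2 het
  exact RingHom.Etale.stableUnderComposition _ _ h2
    (RingHom.Etale.of_bijective (coordEquivCover g h).symm.bijective)

theorem isAbsIrredVariety_coordRing
    (hdom : IsDomain (AlgebraicClosure K ⊗[K] CoverAlgebra g h)) :
    IsAbsIrredVariety K (CoordRing (coverIdeal g h)) :=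
  ⟨inferInstance, (Algebra.TensorProduct.congr (AlgEquiv.refl (R := K) (A₁ := AlgebraicClosure K))
    (coordEquivCover g h)).toMulEquiv.isDomain _⟩

theorem isNormalVariety_coordRing (hdom : IsDomain (CoverAlgebra g h))
    (hic : IsIntegrallyClosed (CoverAlgebra g h)) :
    IsNormalVariety (CoordRing (coverIdeal g h)) :=
  ⟨(coordEquivCover g h).toMulEquiv.isDomain _,
    IsIntegrallyClosed.of_equiv (coordEquivCover g h).symm.toRingEquiv⟩

theorem mapPoint_coverProjection (b : MvPolynomial.zeroLocus K (coverIdeal g h)) :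
    mapPoint (coverProjection g h) b = fun j => b.1 (Fin.castAdd 3 j) := by
  funext j
  rw [mapPoint, coverProjection_algebraMap]
  refine (Ideal.Quotient.lift_mk _ _ _).trans ?_
  simp [baseInclusion]

theorem aeval_baseInclusion (b : Fin (n + 3) → K) (r : MvPolynomial (Fin n) K) :
    MvPolynomial.aeval b (baseInclusion K n r) =
      MvPolynomial.eval (fun j => b (Fin.castAdd 3 j)) r := by
  rw [baseInclusion, MvPolynomial.aeval_rename]; rfl

theorem mem_zeroLocus_coverIdeal (b : Fin (n + 3) → K) :
    b ∈ MvPolynomial.zeroLocus K (coverIdeal g h) ↔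
      MvPolynomial.eval (fun j => b (Fin.castAdd 3 j)) g * b (Fin.natAdd n 0) = 1 ∧
      (specialize h fun j => b (Fin.castAdd 3 j)).eval (b (Fin.natAdd n 1)) = 0 ∧
      b (Fin.natAdd n 2) = 0 := by
  have h1 : MvPolynomial.aeval b (rootEquation h) =
      (specialize h fun j => b (Fin.castAdd 3 j)).eval (b (Fin.natAdd n 1)) := by
    change (MvPolynomial.aeval b).toRingHom (rootEquation h) = _
    rw [rootEquation, hom_eval₂, specialize, eval_map]
    congr 1
    · exact RingHom.ext (aeval_baseInclusion b)
    · exact MvPolynomial.aeval_X _ _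
  rw [coverIdeal, MvPolynomial.zeroLocus_span, coe_coverEquations]
  simp only [Set.mem_insert_iff, Set.mem_singleton_iff, forall_eq_or_imp, forall_eq,
    Set.mem_ofPred_eq, h1, MvPolynomial.aeval_X]
  rw [inverseEquation, map_sub, map_mul, aeval_baseInclusion, MvPolynomial.aeval_X, map_one,
    sub_eq_zero]

theorem eval_ne_zero_of_mapPoint (b : MvPolynomial.zeroLocus K (coverIdeal g h)) :
    mapPoint (coverProjection g h) b ∈ openPoints g := by
  have h1 := ((mem_zeroLocus_coverIdeal g h b.1).1 b.2).1
  rw [mapPoint_coverProjection]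
  exact left_ne_zero_of_mul (h1.trans_ne one_ne_zero)

/-- The rational points of the fibre over `a` are the rational roots of `h(a, Y)`. -/
theorem bijOn_fibre {a : Fin n → K} (ha : a ∈ openPoints g) :
    Set.BijOn (fun b : MvPolynomial.zeroLocus K (coverIdeal g h) => b.1 (Fin.natAdd n 1))
      {b | mapPoint (coverProjection g h) b = a} {η | (specialize h a).eval η = 0} := by
  simp only [mapPoint_coverProjection]
  refine ⟨fun b hb => ?_, fun b hb b' hb' e => ?_, fun η hη => ?_⟩
  · have hb' : (fun j => b.1 (Fin.castAdd 3 j)) = a := hb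
    have h1 := ((mem_zeroLocus_coverIdeal g h b.1).1 b.2).2.1
    rwa [hb'] at h1
  · have hb1 : (fun j => b.1 (Fin.castAdd 3 j)) = a := hb
    have hb1' : (fun j => b'.1 (Fin.castAdd 3 j)) = a := hb'
    have h1 := (mem_zeroLocus_coverIdeal g h b.1).1 b.2
    have h2 := (mem_zeroLocus_coverIdeal g h b'.1).1 b'.2
    rw [hb1] at h1
    rw [hb1'] at h2
    refine Subtype.ext (funext fun i => ?_)
    refine Fin.addCases (fun i => ?_) (fun i => ?_) i
    · exact (congrFun hb1 i).trans (congrFun hb1' i).symm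
    · fin_cases i
      · exact mul_left_cancel₀ ha (h1.1.trans h2.1.symm)
      · exact e
      · exact h1.2.2.trans h2.2.2.symm
  · let b : Fin (n + 3) → K := Fin.append a ![(MvPolynomial.eval a g)⁻¹, η, 0]
    have hba : (fun j => b (Fin.castAdd 3 j)) = a := funext fun j => Fin.append_left _ _ _
    refine ⟨⟨b, (mem_zeroLocus_coverIdeal g h b).2 ?_⟩, hba, ?_⟩
    · rw [hba]
      refine ⟨?_, ?_, ?_⟩
      · rw [show b (Fin.natAdd n 0) = (MvPolynomial.eval a g)⁻¹ from Fin.append_right _ _ _]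
        exact mul_inv_cancel₀ ha
      · rw [show b (Fin.natAdd n 1) = η from Fin.append_right _ _ _]; exact hη
      · exact Fin.append_right _ _ _
    · exact Fin.append_right _ _ _

theorem mem_range_mapPoint (a : Fin n → K) :
    a ∈ Set.range (mapPoint (coverProjection g h)) ↔
      a ∈ openPoints g ∧ ∃ η, (specialize h a).eval η = 0 := by
  constructor
  · rintro ⟨b, rfl⟩
    exact ⟨eval_ne_zero_of_mapPoint g h b, _,
      (bijOn_fibre g h (eval_ne_zero_of_mapPoint g h b)).mapsTo rfl⟩
  · rintro ⟨ha, η, hη⟩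
    obtain ⟨b, hb, -⟩ := (bijOn_fibre g h ha).surjOn hη
    exact ⟨b, hb⟩

end Equiv

end CoordinateRing

/-! ### The choice of the coefficients -/

section Coefficients

/-- This is Dedekind's independence of the characters `ι ∘ s` of `L`. -/
theorem eq_zero_of_sum_conj_mul_eq_zero {K L Ω κ : Type*} [Field K] [Field L] [Field Ω]
    [Algebra K L] [Algebra K Ω] [Fintype (L ≃ₐ[K] L)] (ι : L →ₐ[K] Ω) (b : Module.Basis κ K L)
    {w : (L ≃ₐ[K] L) → Ω} (hw : ∀ k, ∑ s, ι (s (b k)) * w s = 0) : w = 0 := by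
  let Λ : L →ₗ[K] Ω := ∑ s, (LinearMap.mulRight K (w s)).comp
    (ι.toLinearMap.comp (s : L ≃ₗ[K] L).toLinearMap)
  have hΛ : Λ = 0 := b.ext fun k => by
    rw [LinearMap.zero_apply, ← hw k]
    simp [Λ]
  let f : (L ≃ₐ[K] L) → (L →* Ω) := fun s => (ι : L →* Ω).comp (s : L →* L)
  have hf : Function.Injective f := fun s s' e => by
    ext x
    apply ι.toRingHom.injective
    exact congrArg (fun g => g x) e
  have hli := (linearIndependent_monoidHom L Ω).comp f hf
  rw [Fintype.linearIndependent_iff] at hli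
  funext s
  refine hli w ?_ s
  funext x
  have h1 : Λ x = 0 := by rw [hΛ]; rfl
  rw [Pi.zero_apply, ← h1, Finset.sum_apply]
  simp [Λ, f, mul_comm]

variable {K J : Type*} [Field K] [Fintype J] {L : J → Type*} [∀ i, Field (L i)]
  [∀ i, Algebra K (L i)] {κ : J → Type*} [∀ i, Fintype (κ i)]

/-- The conjugates of the elements `∑_k c ^ e(i,k) b_i(k)`, where `b_i` is a basis of `L_i`. -/
def conjFamily {A : Type*} [CommRing A] [Algebra K A] (c : A) (ι : ∀ i, L i →ₐ[K] A)
    (b : ∀ i, Module.Basis (κ i) K (L i)) (e : (Σ i, κ i) → ℕ) : ∀ i, (L i ≃ₐ[K] L i) → A :=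
  fun i s => ∑ k, c ^ e ⟨i, k⟩ * ι i (s (b i k))

/-- The twisted sums are the values at `c` of polynomials of degree at most `B`, which are distinct
by the independence of characters; so only few values of `c` are excluded. -/
theorem exists_twistedSum_injective {Ω : Type*} [Field Ω] [Algebra K Ω]
    [∀ i, Fintype (L i ≃ₐ[K] L i)]
    (ι : ∀ i, L i →ₐ[K] Ω) (b : ∀ i, Module.Basis (κ i) K (L i)) {e : (Σ i, κ i) → ℕ}
    (he : Function.Injective e) {B : ℕ} (hB : ∀ q, e q ≤ B) {u : ∀ i, (L i ≃ₐ[K] L i) → Ω}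
    (hu : ∀ i, Function.Injective (u i)) {c : ℕ → Ω} (hc : Function.Injective c) :
    ∃ k ≤ Nat.card (∀ i, Equiv.Perm (L i ≃ₐ[K] L i)) ^ 2 * B,
      Function.Injective (twistedSum (conjFamily (c k) ι b e) u) := by
  classical
  let G := ∀ i, Equiv.Perm (L i ≃ₐ[K] L i)
  change ∃ k ≤ Nat.card G ^ 2 * B, _
  rw [Nat.card_eq_fintype_card]
  let v : G → (Σ i, κ i) → Ω := fun σ q => ∑ s, ι q.1 (s (b q.1 q.2)) * u q.1 (σ q.1 s)
  -- The twisted sum with parameter `c` is the value of the polynomial `P σ` at `c`.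
  let P : G → Polynomial Ω := fun σ => ∑ q, monomial (e q) (v σ q)
  have hPdeg : ∀ σ, (P σ).natDegree ≤ B := fun σ =>
    natDegree_sum_le_of_forall_le _ _ fun q _ => (natDegree_monomial_le _).trans (hB q)
  have hPeval : ∀ σ x, (P σ).eval x = twistedSum (conjFamily x ι b e) u σ := by
    intro σ x
    simp only [P, v, eval_finsetSum, eval_monomial, twistedSum, conjFamily, Fintype.sum_sigma]
    refine Finset.sum_congr rfl fun i _ => ?_
    simp only [Finset.sum_mul]
    rw [Finset.sum_comm]
    exact Finset.sum_congr rfl fun s _ => Finset.sum_congr rfl fun k _ => by ring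
  have hPinj : Function.Injective P := by
    intro σ σ' h
    have hv : v σ = v σ' := by
      funext q
      have h1 : ∀ σ, (P σ).coeff (e q) = v σ q := fun σ => by
        simp only [P, finsetSum_coeff, coeff_monomial, he.eq_iff]
        simp
      rw [← h1, ← h1, h]
    funext i
    have h2 := eq_zero_of_sum_conj_mul_eq_zero (ι i) (b i)
      (w := fun s => u i (σ i s) - u i (σ' i s)) fun k => by
        have := congrFun hv ⟨i, k⟩
        simp only [v] at this
        simp only [mul_sub, Finset.sum_sub_distrib, this, sub_self]
    ext s
    exact congrFun (congrArg _ (hu i (sub_eq_zero.1 (congrFun h2 s)))) _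
  let Q : Polynomial Ω := ∏ p ∈ Finset.univ.offDiag, (P p.1 - P p.2)
  have hQ : Q ≠ 0 := Finset.prod_ne_zero_iff.2 fun p hp =>
    sub_ne_zero.2 fun h => (Finset.mem_offDiag.1 hp).2.2 (hPinj h)
  have hQdeg : Q.natDegree ≤ Fintype.card G ^ 2 * B := by
    refine (natDegree_prod_le _ _).trans ?_
    refine (Finset.sum_le_card_nsmul _ _ B fun p _ =>
      (natDegree_sub_le _ _).trans (max_le (hPdeg _) (hPdeg _))).trans ?_
    rw [smul_eq_mul]
    refine Nat.mul_le_mul_right _ ?_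
    rw [Finset.offDiag_card, sq]
    exact Nat.sub_le _ _
  have hk : ∃ k ∈ Finset.range (Fintype.card G ^ 2 * B + 1), Q.eval (c k) ≠ 0 := by
    by_contra! hall
    refine hQ (eq_zero_of_natDegree_lt_card_of_eval_eq_zero' Q
      ((Finset.range (Fintype.card G ^ 2 * B + 1)).image c) ?_ ?_)
    · intro x hx
      obtain ⟨k, hk, rfl⟩ := Finset.mem_image.1 hx
      exact hall k hk
    · rw [Finset.card_image_of_injective _ hc, Finset.card_range]
      omega
  obtain ⟨k, hk, hQk⟩ := hk
  refine ⟨k, Nat.lt_succ_iff.1 (Finset.mem_range.1 hk), fun σ σ' h => ?_⟩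
  by_contra hne
  apply hQk
  rw [eval_prod]
  refine Finset.prod_eq_zero (i := (σ, σ')) (by simp [hne]) ?_
  rw [eval_sub, hPeval, hPeval, h, sub_self]

end Coefficients

/-! ### The roots of the given polynomials -/

section Roots

theorem map_eq_prod_X_sub_C_of_roots {A Ω H : Type*} [CommRing A] [Field Ω] [Algebra A Ω]
    [Fintype H] {q : A[X]} (hq : q.Monic) {u : H → Ω} (hu : Function.Injective u)
    (hroot : ∀ s, aeval (u s) q = 0) (hcard : q.natDegree ≤ Fintype.card H) :
    q.map (algebraMap A Ω) = ∏ s, (X - C (u s)) := by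
  refine eq_of_monic_of_dvd_of_natDegree_le (monic_prod_of_monic _ _ fun s _ => monic_X_sub_C _)
    (hq.map _) (prod_X_sub_C_dvd hu fun s => ?_) ?_
  · rw [eval_map_algebraMap]; exact hroot s
  · rw [natDegree_finsetProd_X_sub_C_eq_card, hq.natDegree_map]; exact hcard

/-- The normalizations of the `f_i` are monic, so that their roots are integral over `K[A]`. The
automorphisms of `Ω` permute these roots arbitrarily, by the hypothesis on the Galois group, even
those that fix given constants, by regularity. -/
theorem exists_roots {K : Type u} [Field K] {n r : ℕ} {f : Fin r → (MvPolynomial (Fin n) K)[X]}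
    {d : Fin r → ℕ} {H : Fin r → Type*} [∀ i, Fintype (H i)] (hH : ∀ i, Fintype.card (H i) = d i)
    (hd : ∀ i, 0 < d i) (hsep : ∀ i, (overRatFunc (f i)).Separable)
    (hdeg : ∀ i, (f i).natDegree = d i)
    (hgal : Nonempty
      ((overRatFunc (∏ i, f i)).Gal ≃* ((i : Fin r) → Equiv.Perm (Fin (d i)))))
    (hreg : algebraicClosure K (overRatFunc (∏ i, f i)).SplittingField = ⊥) :
    ∃ u : ∀ i, H i → AlgebraicClosure (RatField K n),
      (∀ i, (f i).integralNormalization.map (algebraMap _ _) = ∏ s, (X - C (u i s))) ∧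
      (∀ i, Function.Injective (u i)) ∧
      (∀ i s, IsSeparable (RatField K n) (u i s)) ∧
      ∀ (σ : ∀ i, Equiv.Perm (H i)) (S : Finset (AlgebraicClosure (RatField K n))),
        (∀ s ∈ S, IsIntegral K s) →
        ∃ α : AlgebraicClosure (RatField K n) ≃ₐ[RatField K n] AlgebraicClosure (RatField K n),
          (∀ i s, α (u i s) = u i (σ i s)) ∧ ∀ s ∈ S, α s = s := by
  classical
  set R := MvPolynomial (Fin n) K with hR
  set E := RatField K n with hE
  let Ω := AlgebraicClosure E
  let p : E[X] := overRatFunc (∏ i, f i)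
  let F := p.SplittingField
  have hp : p = ∏ i, overRatFunc (f i) := by
    simp only [p, overRatFunc, Polynomial.map_prod]
  have hRE : Function.Injective (algebraMap R E) := IsFractionRing.injective R E
  have hRΩ : Function.Injective (algebraMap R Ω) := by
    rw [IsScalarTower.algebraMap_eq R E Ω]
    exact (algebraMap E Ω).injective.comp hRE
  have hf0 : ∀ i, f i ≠ 0 := fun i h => by
    have := hdeg i
    rw [h, natDegree_zero] at this
    exact absurd this (hd i).ne
  have hfE0 : ∀ i, overRatFunc (f i) ≠ 0 := fun i => (hsep i).ne_zero
  have hp0 : p ≠ 0 := by rw [hp]; exact Finset.prod_ne_zero_iff.2 fun i _ => hfE0 i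
  have hsplit : ∀ i, ((overRatFunc (f i)).map (algebraMap E F)).Splits := fun i => by
    refine (SplittingField.splits p).of_dvd (map_ne_zero hp0) ?_
    refine Polynomial.map_dvd _ ?_
    rw [hp]
    exact Finset.dvd_prod_of_mem _ (Finset.mem_univ i)
  have hcard : ∀ i, Fintype.card ((overRatFunc (f i)).rootSet F) = Fintype.card (H i) := fun i => by
    rw [card_rootSet_eq_natDegree (hsep i) (hsplit i), hH, ← hdeg i]
    exact natDegree_map_eq_of_injective hRE _
  let t : ∀ i, H i → F := fun i s => ((Fintype.equivOfCardEq (hcard i)).symm s : F)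
  have ht : ∀ i, Function.Injective (t i) := fun i =>
    Subtype.val_injective.comp (Equiv.injective _)
  have htr : ∀ i x, aeval x (overRatFunc (f i)) = 0 ↔ ∃ s, t i s = x := by
    intro i x
    constructor
    · intro hx
      refine ⟨Fintype.equivOfCardEq (hcard i) ⟨x, mem_rootSet.2 ⟨hfE0 i, hx⟩⟩, ?_⟩
      simp [t]
    · rintro ⟨s, rfl⟩
      exact (mem_rootSet.1 ((Fintype.equivOfCardEq (hcard i)).symm s).2).2
  have hpr : ∀ x : F, aeval x p = 0 → ∃ i s, t i s = x := by
    intro x hx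
    replace hx := (congrArg (aeval x) hp).symm.trans hx
    rw [map_prod, Finset.prod_eq_zero_iff] at hx
    obtain ⟨i, -, hi⟩ := hx
    exact ⟨i, (htr i x).1 hi⟩
  have hGcard : Nat.card p.Gal = Nat.card (∀ i, Equiv.Perm (H i)) := by
    rw [Nat.card_congr hgal.some.toEquiv, Nat.card_pi, Nat.card_pi]
    refine Finset.prod_congr rfl fun i _ => ?_
    rw [Nat.card_perm, Nat.card_perm, Nat.card_eq_fintype_card, Nat.card_eq_fintype_card,
      Fintype.card_fin, hH]
  let φ : F →ₐ[E] Ω := IsAlgClosed.lift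
  let : Algebra F Ω := φ.toRingHom.toAlgebra
  have : IsScalarTower E F Ω := IsScalarTower.of_algebraMap_eq fun x => (φ.commutes x).symm
  have : IsScalarTower K F Ω := IsScalarTower.of_algebraMap_eq fun x => by
    rw [IsScalarTower.algebraMap_apply K E F, ← IsScalarTower.algebraMap_apply E F Ω,
      ← IsScalarTower.algebraMap_apply K E Ω]
  have hlc : ∀ i, algebraMap R Ω (f i).leadingCoeff ≠ 0 := fun i =>
    (map_ne_zero_iff _ hRΩ).2 (leadingCoeff_ne_zero.2 (hf0 i))
  have htf : ∀ i s, aeval (algebraMap F Ω (t i s)) (overRatFunc (f i)) = 0 := fun i s => by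
    rw [aeval_algebraMap_apply, (htr i _).2 ⟨s, rfl⟩, map_zero]
  let u : ∀ i, H i → Ω := fun i s => algebraMap R Ω (f i).leadingCoeff * algebraMap F Ω (t i s)
  have hu : ∀ i, Function.Injective (u i) := fun i s s' e =>
    ht i ((algebraMap F Ω).injective (mul_left_cancel₀ (hlc i) e))
  refine ⟨u, fun i => ?_, hu, fun i s => ?_, fun σ S hS => ?_⟩
  · refine map_eq_prod_X_sub_C_of_roots (monic_integralNormalization (hf0 i)) (hu i)
      (fun s => ?_) ?_
    · refine integralNormalization_aeval_eq_zero ?_ fun x hx => (map_eq_zero_iff _ hRΩ).1 hx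
      rw [← htf i s, overRatFunc, aeval_map_algebraMap]
    · rw [natDegree_integralNormalization, hdeg, hH]
  · have h1 : IsSeparable E (algebraMap F Ω (t i s)) :=
      (hsep i).of_dvd (minpoly.dvd _ _ (htf i s))
    rw [← mem_separableClosure_iff]
    refine mul_mem ?_ (mem_separableClosure_iff.2 h1)
    rw [IsScalarTower.algebraMap_apply R E Ω]
    exact IntermediateField.algebraMap_mem _ _
  · obtain ⟨γ, hγ⟩ := exists_gal_of_card ht htr hpr hGcard σ
    obtain ⟨α, hα, hαS⟩ := exists_extension_fixing (Ω := Ω) hreg γ S hS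
    refine ⟨α, fun i s => ?_, hαS⟩
    simp only [u]
    rw [map_mul, hα, hγ, IsScalarTower.algebraMap_apply R E Ω, α.commutes]

end Roots

/-! ### The covering -/

/-- The discriminant, up to sign, is the resultant of `h` and `h'`, which gives the relation. -/
theorem exists_discriminant {A Ω G : Type*} [CommRing A] [Field Ω] [Algebra A Ω] [Fintype G]
    [DecidableEq G] [Nonempty G] (hA : Function.Injective (algebraMap A Ω)) {y : G → Ω} {h : A[X]}
    (e : h.map (algebraMap A Ω) = ∏ σ, (X - C (y σ))) :
    ∃ D : A, (∃ p₁ p₂, h * p₁ + derivative h * p₂ = C D) ∧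
      algebraMap A Ω D = ∏ σ, ∏ τ ∈ Finset.univ.erase σ, (y σ - y τ) := by
  have hdeg : h.natDegree = Fintype.card G := natDegree_of_map_eq_prod_X_sub_C _ hA _ _ e
  have hdeg' : (derivative h).natDegree ≤ h.natDegree :=
    (natDegree_derivative_le h).trans (Nat.sub_le _ _)
  have hm := monic_of_map_eq_prod_X_sub_C _ hA _ _ e
  refine ⟨h.resultant (derivative h) h.natDegree h.natDegree, ?_, ?_⟩
  · obtain ⟨p₁, p₂, -, -, hp⟩ := exists_mul_add_mul_eq_C_resultant h (derivative h) le_rfl hdeg'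
      (Or.inl (by rw [hdeg]; exact Fintype.card_ne_zero))
    exact ⟨p₁, p₂, hp⟩
  · have hsplit : (h.map (algebraMap A Ω)).Splits := by
      rw [e]; exact Splits.prod fun σ _ => Splits.X_sub_C _
    have h1 := resultant_eq_prod_eval (h.map (algebraMap A Ω))
      ((derivative h).map (algebraMap A Ω)) h.natDegree (natDegree_map_le.trans hdeg') hsplit
    have hroots : (h.map (algebraMap A Ω)).roots = Finset.univ.val.map y := by
      rw [e]
      have := roots_multiset_prod_X_sub_C (Finset.univ.val.map y)
      rwa [Multiset.map_map] at this
    rw [(hm.map _).leadingCoeff, one_pow, one_mul, natDegree_map_eq_of_injective hA,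
      resultant_map_map, hroots, Multiset.map_map] at h1
    rw [h1]
    change ∏ σ, _ = _
    refine Finset.prod_congr rfl fun σ _ => ?_
    rw [Function.comp_apply, ← derivative_map, e]
    change eval _ (derivative (Lagrange.nodal Finset.univ y)) = _
    rw [Lagrange.eval_nodal_derivative_eval_node_eq (Finset.mem_univ σ), Lagrange.eval_nodal]

section Localized

variable {K : Type u} [Field K] {n : ℕ}

/-- Over the open set `g ≠ 0` the polynomial `h` is separable, as its discriminant `D` divides
`g`. -/
theorem coverAlgebra_properties {G : Type*} [Fintype G]
    {y : G → AlgebraicClosure (RatField K n)} {h : (MvPolynomial (Fin n) K)[X]}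
    (hy : Function.Injective y) (hs : ∀ σ, IsSeparable (RatField K n) (y σ))
    (e : h.map (algebraMap _ _) = ∏ σ, (X - C (y σ)))
    (hperm : ∀ β : AlgebraicClosure (RatField K n) ≃ₐ[RatField K n] AlgebraicClosure (RatField K n),
      ∃ π : Equiv.Perm G, ∀ σ, β (y σ) = y (π σ)) {σ₀ : G}
    (htrans : ∀ S : Finset (AlgebraicClosure (RatField K n)), (∀ s ∈ S, IsIntegral K s) → ∀ σ,
      ∃ α : AlgebraicClosure (RatField K n) ≃ₐ[RatField K n] AlgebraicClosure (RatField K n),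
      α (y σ₀) = y σ ∧ ∀ s ∈ S, α s = s)
    {D : MvPolynomial (Fin n) K} (hD : ∃ p₁ p₂, h * p₁ + derivative h * p₂ = C D)
    {g : MvPolynomial (Fin n) K} (hg : g ≠ 0) (hDg : D ∣ g) :
    Algebra.Etale (OpenCoordRing g) (CoverAlgebra g h) ∧ IsDomain (CoverAlgebra g h) ∧
      IsIntegrallyClosed (CoverAlgebra g h) ∧
      IsDomain (AlgebraicClosure K ⊗[K] CoverAlgebra g h) := by
  let R := MvPolynomial (Fin n) K
  let E := RatField K n
  let Ω := AlgebraicClosure E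
  let A := OpenCoordRing g
  have hRE : Function.Injective (algebraMap R E) := IsFractionRing.injective R E
  have hRΩ : Function.Injective (algebraMap R Ω) := by
    rw [IsScalarTower.algebraMap_eq R E Ω]
    exact (algebraMap E Ω).injective.comp hRE
  have hgE : IsUnit (algebraMap R E g) := by
    rw [isUnit_iff_ne_zero, Ne, map_eq_zero_iff _ hRE]; exact hg
  let φ : A →+* E := IsLocalization.Away.lift g hgE
  let : Algebra A E := φ.toAlgebra
  have : IsScalarTower R A E := IsScalarTower.of_algebraMap_eq fun x =>
    (IsLocalization.Away.lift_eq g hgE x).symm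
  have : IsScalarTower R A Ω := IsScalarTower.of_algebraMap_eq fun x => by
    rw [IsScalarTower.algebraMap_apply A E Ω, ← IsScalarTower.algebraMap_apply R A E,
      ← IsScalarTower.algebraMap_apply R E Ω]
  have : IsScalarTower K A Ω := IsScalarTower.of_algebraMap_eq fun x => by
    rw [IsScalarTower.algebraMap_apply K R A, ← IsScalarTower.algebraMap_apply R A Ω,
      ← IsScalarTower.algebraMap_apply K R Ω]
  have : IsFractionRing A E :=
    IsFractionRing.isFractionRing_of_isDomain_of_isLocalization (Submonoid.powers g) A E
  have hgM : Submonoid.powers g ≤ nonZeroDivisors R :=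
    powers_le_nonZeroDivisors_of_noZeroDivisors hg
  have : IsIntegrallyClosed A := isIntegrallyClosed_of_isLocalization A (Submonoid.powers g) hgM
  have hAΩ : Function.Injective (algebraMap A Ω) := by
    rw [IsScalarTower.algebraMap_eq A E Ω]
    exact (algebraMap E Ω).injective.comp (IsFractionRing.injective A E)
  have hm : h.Monic := monic_of_map_eq_prod_X_sub_C _ hRΩ _ _ e
  have eA : (h.map (algebraMap R A)).map (algebraMap A Ω) = ∏ σ, (X - C (y σ)) := by
    rw [Polynomial.map_map, ← IsScalarTower.algebraMap_eq R A Ω, e]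
  have hcop : IsCoprime (h.map (algebraMap R A)) (derivative (h.map (algebraMap R A))) := by
    obtain ⟨p₁, p₂, hp⟩ := hD
    have hu : IsUnit (algebraMap R A D) :=
      isUnit_of_dvd_unit (map_dvd _ hDg) (IsLocalization.Away.algebraMap_isUnit g)
    obtain ⟨c, hc⟩ := hu.exists_left_inv
    refine ⟨C c * p₁.map (algebraMap R A), C c * p₂.map (algebraMap R A), ?_⟩
    have h1 := congrArg (fun p => C c * p.map (algebraMap R A)) hp
    simp only [Polynomial.map_add, Polynomial.map_mul, map_C, ← C_mul, hc, C_1] at h1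
    rw [← h1, derivative_map]
    ring
  have htrans' : ∀ σ, ∃ α : Ω ≃ₐ[E] Ω, α (y σ₀) = y σ := fun σ => by
    obtain ⟨α, hα, -⟩ := htrans ∅ (by simp) σ
    exact ⟨α, hα⟩
  obtain ⟨h1, h2⟩ := isIntegrallyClosed_adjoinRoot (E := E) hy hs eA hperm htrans' hcop
  refine ⟨etale_adjoinRoot (hm.map _) hcop, h1, h2, ?_⟩
  let ψ : AlgebraicClosure K →ₐ[K] Ω := IsAlgClosed.lift
  let : Algebra (AlgebraicClosure K) Ω := ψ.toRingHom.toAlgebra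
  have : IsScalarTower K (AlgebraicClosure K) Ω :=
    IsScalarTower.of_algebraMap_eq fun x => (ψ.commutes x).symm
  let b := Module.Basis.ofVectorSpace K (AlgebraicClosure K)
  refine isDomain_tensorProduct_adjoinRoot (E := E) hAΩ hy eA htrans b ?_
  rw [LinearIndependent.iff_fractionRing A E, ← LinearIndependent.iff_fractionRing R E]
  exact linearIndependent_mvPolynomial hRΩ b.linearIndependent

end Localized

section Specialization

variable {K : Type u} [Field K] {n : ℕ} {J : Type*} [Fintype J]
  {L : J → Type*} [∀ i, Field (L i)] [∀ i, Algebra K (L i)] [∀ i, FiniteDimensional K (L i)]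
  [∀ i, IsGalois K (L i)] [Fintype (∀ i, Equiv.Perm (L i ≃ₐ[K] L i))]
  {κ : J → Type*} [∀ i, Fintype (κ i)] {Ω : Type*} [Field Ω] [Algebra K Ω]
  [Algebra (MvPolynomial (Fin n) K) Ω] [IsScalarTower K (MvPolynomial (Fin n) K) Ω]

/-- The rational points of the specialization at `a`, obtained by reducing all the roots modulo a
prime above `a`. -/
theorem points_of_specialization (hinj : Function.Injective (algebraMap (MvPolynomial (Fin n) K) Ω))
    {ι : ∀ i, L i →ₐ[K] Ω} {b : ∀ i, Module.Basis (κ i) K (L i)} {ex : (Σ i, κ i) → ℕ}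
    {u : ∀ i, (L i ≃ₐ[K] L i) → Ω} {q : J → (MvPolynomial (Fin n) K)[X]}
    {c : MvPolynomial (Fin n) K} {h : (MvPolynomial (Fin n) K)[X]}
    (hq : ∀ i, (q i).map (algebraMap _ _) = ∏ s, (X - C (u i s)))
    (e : h.map (algebraMap _ _) =
      ∏ σ, (X - C (twistedSum (conjFamily (algebraMap _ Ω c) ι b ex) u σ)))
    {D : MvPolynomial (Fin n) K} (hD : ∃ p₁ p₂, h * p₁ + derivative h * p₂ = C D)
    {a : Fin n → K} (ha : MvPolynomial.eval a D ≠ 0) :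
    ((∃ η, (specialize h a).eval η = 0) ↔ ∀ i, GeneratedByRoot (L i) (specialize (q i) a)) ∧
    ((∃ η, (specialize h a).eval η = 0) →
      {η | (specialize h a).eval η = 0}.ncard = ∏ i, Module.finrank K (L i)) := by
  let R := MvPolynomial (Fin n) K
  let M := AlgebraicClosure K
  let O := integralClosure R Ω
  have hRO : Function.Injective (algebraMap R O) := fun x y hxy => hinj (congrArg Subtype.val hxy)
  have hOΩ : Function.Injective (algebraMap O Ω) := Subtype.val_injective
  let ev : R →ₐ[K] K := MvPolynomial.aeval a
  have hev : (ev : R →+* K) = MvPolynomial.eval a := MvPolynomial.coe_aeval_eq_eval a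
  obtain ⟨ψ, hψ⟩ := exists_ringHom_of_isIntegral (M := M) (O := O) hRO ev
  have hψc : ψ.comp (algebraMap R O) = (algebraMap K M).comp (ev : R →+* K) := RingHom.ext hψ
  have hu : ∀ i s, IsIntegral R (u i s) := fun i s =>
    ⟨q i, monic_of_map_eq_prod_X_sub_C _ hinj _ _ (hq i), aeval_eq_zero_of_map_eq_prod (hq i)⟩
  have hι : ∀ i x, IsIntegral R (ι i x) := fun i x =>
    ((Algebra.IsIntegral.isIntegral (R := K) x).map (ι i)).tower_top
  let uO : ∀ i, (L i ≃ₐ[K] L i) → O := fun i s => ⟨u i s, hu i s⟩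
  let ιO : ∀ i, L i →ₐ[K] O := fun i => (ι i).codRestrict (O.restrictScalars K) (hι i)
  let j : ∀ i, L i →ₐ[K] M := fun i =>
    { ψ.comp (ιO i : L i →+* O) with
      commutes' := fun k => by
        change ψ (ιO i (algebraMap K (L i) k)) = _
        rw [(ιO i).commutes]
        have hk : algebraMap K O k = algebraMap R O (algebraMap K R k) :=
          Subtype.ext (IsScalarTower.algebraMap_apply K R Ω k)
        rw [hk]
        exact (hψ (algebraMap K R k)).trans (congrArg _ (ev.commutes k)) }
  let τ : ∀ i, (L i ≃ₐ[K] L i) → M := fun i s => ψ (uO i s)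
  let m : ∀ i, L i := fun i => ∑ k, ev c ^ ex ⟨i, k⟩ • b i k
  have hspec : ∀ p : R[X], (specialize p a).map (algebraMap K M) =
      (p.map (algebraMap R O)).map ψ := by
    intro p
    rw [specialize, ← hev, Polynomial.map_map, Polynomial.map_map, hψc]
  have hqO : ∀ i, (specialize (q i) a).map (algebraMap K M) = ∏ s, (X - C (τ i s)) := by
    intro i
    have h1 : (q i).map (algebraMap R O) = ∏ s, (X - C (uO i s)) := by
      apply map_injective _ hOΩ
      rw [map_prod_X_sub_C, Polynomial.map_map, ← IsScalarTower.algebraMap_eq R O Ω, hq]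
      rfl
    rw [hspec, h1, map_prod_X_sub_C]
  have hm : ∀ i s, ψ (conjFamily (algebraMap R O c) ιO b ex i s) = j i (s (m i)) := by
    intro i s
    simp only [conjFamily, m, map_sum, map_mul, map_pow, hψ, map_smul]
    refine Finset.sum_congr rfl fun k _ => ?_
    rw [Algebra.smul_def, map_pow]
    rfl
  have hhO : (specialize h a).map (algebraMap K M) =
      ∏ σ, (X - C (twistedSum (fun i s => j i (s (m i))) τ σ)) := by
    have h1 : h.map (algebraMap R O) =
        ∏ σ, (X - C (twistedSum (conjFamily (algebraMap R O c) ιO b ex) uO σ)) := by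
      apply map_injective _ hOΩ
      rw [map_prod_X_sub_C, Polynomial.map_map, ← IsScalarTower.algebraMap_eq R O Ω, e]
      refine Finset.prod_congr rfl fun σ _ => ?_
      congr 2
      rw [map_twistedSum]
      congr 1
      funext i s
      simp only [conjFamily, map_sum, map_mul, map_pow]
      rfl
    rw [hspec, h1, map_prod_X_sub_C]
    refine Finset.prod_congr rfl fun σ _ => ?_
    rw [map_twistedSum]
    simp only [hm]
    rfl
  have hsep : (specialize h a).Separable := by
    obtain ⟨p₁, p₂, hp⟩ := hD
    have h1 := congrArg (fun p => C (MvPolynomial.eval a D)⁻¹ * p.map (MvPolynomial.eval a)) hp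
    simp only [Polynomial.map_add, Polynomial.map_mul, map_C, ← C_mul, inv_mul_cancel₀ ha,
      C_1] at h1
    refine ⟨C (MvPolynomial.eval a D)⁻¹ * p₁.map (MvPolynomial.eval a),
      C (MvPolynomial.eval a D)⁻¹ * p₂.map (MvPolynomial.eval a), ?_⟩
    rw [← h1, specialize, derivative_map]
    ring
  have hyinj : Function.Injective (twistedSum (fun i s => j i (s (m i))) τ) := by
    rw [← separable_map (algebraMap K M), hhO] at hsep
    exact separable_prod_X_sub_C_iff.1 hsep
  exact ncard_roots_of_generatedByRoot hqO hyinj hhO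

end Specialization

section TotalDegree

variable {K : Type u} [Field K] {n : ℕ}

theorem totalDegree_coeff_add_le (f : (MvPolynomial (Fin n) K)[X]) {k : ℕ} (hk : f.coeff k ≠ 0) :
    (f.coeff k).totalDegree + k ≤ totalDeg f := by
  have h1 := MvPolynomial.totalDegree_coeff_finSuccEquiv_add_le
    ((MvPolynomial.finSuccEquiv K n).symm f) k
  rw [AlgEquiv.apply_symm_apply] at h1
  exact h1 hk

theorem totalDegree_coeff_le_totalDeg (f : (MvPolynomial (Fin n) K)[X]) (k : ℕ) :
    (f.coeff k).totalDegree ≤ totalDeg f := by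
  by_cases hk : f.coeff k = 0
  · simp [hk]
  · exact (Nat.le_add_right _ _).trans (totalDegree_coeff_add_le f hk)

theorem natDegree_le_totalDeg (f : (MvPolynomial (Fin n) K)[X]) :
    f.natDegree ≤ totalDeg f := by
  by_cases hf : f = 0
  · simp [hf]
  · exact (Nat.le_add_left _ _).trans
      (totalDegree_coeff_add_le f (leadingCoeff_ne_zero.2 hf))

/-- The coefficient of `T ^ k` in the normalization of `f` is the one of `f` times a power of the
leading coefficient with exponent `natDegree f - 1 - k`, so it has the degree that is required by
`hasWeight_of_root`. -/
theorem hasWeight_root_integralNormalization {Ω : Type*} [Field Ω]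
    [Algebra (MvPolynomial (Fin n) K) Ω] {f : (MvPolynomial (Fin n) K)[X]} (hf : f ≠ 0) {z : Ω}
    (hz : aeval z f.integralNormalization = 0) : HasWeight (Fin n) K (totalDeg f) z := by
  refine hasWeight_of_root (monic_integralNormalization hf) (fun k hk => ?_) hz
  rw [natDegree_integralNormalization] at hk ⊢
  rcases hk.eq_or_lt with rfl | hlt
  · rw [integralNormalization_coeff_natDegree hf]; simp
  rw [integralNormalization_coeff_ne_natDegree hlt.ne]
  refine (MvPolynomial.totalDegree_mul _ _).trans ?_
  obtain ⟨j, hj⟩ : ∃ j, f.natDegree = k + j + 1 := ⟨f.natDegree - 1 - k, by omega⟩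
  rw [hj, show k + j + 1 - 1 - k = j by omega, show k + j + 1 - k = j + 1 by omega, add_mul,
    one_mul, add_comm]
  refine Nat.add_le_add ?_ (totalDegree_coeff_le_totalDeg f k)
  exact (MvPolynomial.totalDegree_pow _ _).trans
    (Nat.mul_le_mul_left _ (totalDegree_coeff_le_totalDeg f _))

end TotalDegree

section Cover

variable {K : Type u} [Field K] {n : ℕ} {J : Type*} [Fintype J]
  {L : J → Type*} [∀ i, Field (L i)] [∀ i, Algebra K (L i)] [∀ i, FiniteDimensional K (L i)]
  {κ : J → Type*} [∀ i, Fintype (κ i)]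

/-- A parameter of small degree for which the twisted sums are distinct: a power of the variable
`A_1`, which works over a finite field of constants too. Without variables all roots are constants,
so that there is only one twisted sum. -/
theorem exists_parameter {ι : ∀ i, L i →ₐ[K] AlgebraicClosure (RatField K n)}
    {b : ∀ i, Module.Basis (κ i) K (L i)} {ex : (Σ i, κ i) → ℕ} (hex : Function.Injective ex)
    {B : ℕ} (hB : ∀ q, ex q ≤ B) {u : ∀ i, (L i ≃ₐ[K] L i) → AlgebraicClosure (RatField K n)}
    (hu : ∀ i, Function.Injective (u i))
    (hint : ∀ i s, IsIntegral (MvPolynomial (Fin n) K) (u i s))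
    (haut : ∀ (σ : ∀ i, Equiv.Perm (L i ≃ₐ[K] L i)) (S : Finset (AlgebraicClosure (RatField K n))),
        (∀ s ∈ S, IsIntegral K s) →
        ∃ α : AlgebraicClosure (RatField K n) ≃ₐ[RatField K n] AlgebraicClosure (RatField K n),
          (∀ i s, α (u i s) = u i (σ i s)) ∧ ∀ s ∈ S, α s = s) :
    ∃ c : MvPolynomial (Fin n) K,
      c.totalDegree ≤ Nat.card (∀ i, Equiv.Perm (L i ≃ₐ[K] L i)) ^ 2 * B ∧
      Function.Injective (twistedSum (conjFamily (algebraMap _ _ c) ι b ex) u) := by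
  classical
  have hRΩ : Function.Injective (algebraMap (MvPolynomial (Fin n) K)
      (AlgebraicClosure (RatField K n))) := by
    rw [IsScalarTower.algebraMap_eq _ (RatField K n) _]
    exact (algebraMap (RatField K n) _).injective.comp (IsFractionRing.injective _ _)
  cases n with
  | zero =>
    refine ⟨0, by simp, fun σ σ' _ => ?_⟩
    have hK : Algebra.IsIntegral K (MvPolynomial (Fin 0) K) :=
      Algebra.isIntegral_of_surjective (MvPolynomial.C_surjective (Fin 0))
    have hone : ∀ σ : ∀ i, Equiv.Perm (L i ≃ₐ[K] L i), σ = 1 := by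
      intro σ
      obtain ⟨α, hα, hfix⟩ := haut σ
        (Finset.univ.image fun p : Σ i, (L i ≃ₐ[K] L i) => u p.1 p.2) (by
          intro x hx
          obtain ⟨p, -, rfl⟩ := Finset.mem_image.1 hx
          exact isIntegral_trans _ (hint p.1 p.2))
      funext i
      ext s : 1
      apply hu i
      rw [← hα]
      exact hfix _ (Finset.mem_image.2 ⟨⟨i, s⟩, Finset.mem_univ _, rfl⟩)
    rw [hone σ, hone σ']
  | succ n =>
    have hc : Function.Injective fun k : ℕ =>
        algebraMap _ (AlgebraicClosure (RatField K (n + 1)))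
          (MvPolynomial.X 0 ^ k : MvPolynomial (Fin (n + 1)) K) := by
      intro k k' h
      have h1 := congrArg MvPolynomial.totalDegree (hRΩ h)
      simpa [MvPolynomial.totalDegree_X_pow] using h1
    obtain ⟨k, hk, hinj⟩ := exists_twistedSum_injective ι b hex hB hu hc
    exact ⟨MvPolynomial.X 0 ^ k, by rwa [MvPolynomial.totalDegree_X_pow], hinj⟩

/-- The polynomial `h` has the twisted sums as its roots, and `D` is its discriminant. The bound `w`
for the weight of the twisted sums is that of `c ^ e`, with `c` from `exists_parameter` and `e ≤ B`,
plus the bound `δ` for the roots. -/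
theorem exists_cover_polynomial [∀ i, IsGalois K (L i)] [Fintype (∀ i, Equiv.Perm (L i ≃ₐ[K] L i))]
    {q : J → (MvPolynomial (Fin n) K)[X]}
    {u : ∀ i, (L i ≃ₐ[K] L i) → AlgebraicClosure (RatField K n)}
    (hq : ∀ i, (q i).map (algebraMap _ _) = ∏ s, (X - C (u i s)))
    (hu : ∀ i, Function.Injective (u i)) (hus : ∀ i s, IsSeparable (RatField K n) (u i s))
    (haut : ∀ (σ : ∀ i, Equiv.Perm (L i ≃ₐ[K] L i)) (S : Finset (AlgebraicClosure (RatField K n))),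
        (∀ s ∈ S, IsIntegral K s) →
        ∃ α : AlgebraicClosure (RatField K n) ≃ₐ[RatField K n] AlgebraicClosure (RatField K n),
          (∀ i s, α (u i s) = u i (σ i s)) ∧ ∀ s ∈ S, α s = s)
    {δ : ℕ} (hw : ∀ i s, HasWeight (Fin n) K δ (u i s))
    {N B w : ℕ} (hN : Fintype.card (∀ i, Equiv.Perm (L i ≃ₐ[K] L i)) = N)
    (hBL : ∑ i, Module.finrank K (L i) = B) (hwdef : N ^ 2 * B * B + δ = w) :
    ∃ h : (MvPolynomial (Fin n) K)[X], ∃ D : MvPolynomial (Fin n) K,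
      h.Monic ∧ h.natDegree = N ∧ (∀ k, (h.coeff k).totalDegree ≤ w * N) ∧
      D ≠ 0 ∧ D.totalDegree ≤ w * N * N ∧
      (∀ g : MvPolynomial (Fin n) K, g ≠ 0 → D ∣ g →
        Algebra.Etale (OpenCoordRing g) (CoverAlgebra g h) ∧ IsDomain (CoverAlgebra g h) ∧
        IsIntegrallyClosed (CoverAlgebra g h) ∧
        IsDomain (AlgebraicClosure K ⊗[K] CoverAlgebra g h)) ∧
      ∀ a : Fin n → K, MvPolynomial.eval a D ≠ 0 →
        ((∃ η, (specialize h a).eval η = 0) ↔ ∀ i, GeneratedByRoot (L i) (specialize (q i) a)) ∧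
        ((∃ η, (specialize h a).eval η = 0) →
          {η | (specialize h a).eval η = 0}.ncard = ∏ i, Module.finrank K (L i)) := by
  classical
  let R := MvPolynomial (Fin n) K
  let E := RatField K n
  let Ω := AlgebraicClosure E
  let G := ∀ i, Equiv.Perm (L i ≃ₐ[K] L i)
  have hRE : Function.Injective (algebraMap R E) := IsFractionRing.injective R E
  have hRΩ : Function.Injective (algebraMap R Ω) := by
    rw [IsScalarTower.algebraMap_eq R E Ω]
    exact (algebraMap E Ω).injective.comp hRE
  have hint : ∀ i s, IsIntegral R (u i s) := fun i s =>
    ⟨q i, monic_of_map_eq_prod_X_sub_C _ hRΩ _ _ (hq i), aeval_eq_zero_of_map_eq_prod (hq i)⟩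
  let ι : ∀ i, L i →ₐ[K] Ω := fun i => IsAlgClosed.lift
  let b : ∀ i, Module.Basis (Fin (Module.finrank K (L i))) K (L i) := fun i =>
    Module.finBasis K (L i)
  let ex : (Σ i, Fin (Module.finrank K (L i))) → ℕ := fun p => Fintype.equivFin _ p
  have hex : Function.Injective ex := Fin.val_injective.comp (Equiv.injective _)
  have hB : ∀ p, ex p ≤ B := fun p => by
    refine (Fin.is_lt _).le.trans ?_
    rw [Fintype.card_sigma, ← hBL]
    simp
  obtain ⟨c, hc, hy⟩ := exists_parameter (ι := ι) (b := b) hex hB hu hint haut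
  rw [Nat.card_eq_fintype_card, hN] at hc
  set μ := conjFamily (algebraMap R Ω c) ι b ex with hμ
  set y : G → Ω := twistedSum μ u with hydef
  have hιK : ∀ i x, IsIntegral K (ι i x) := fun i x =>
    (Algebra.IsIntegral.isIntegral (R := K) x).map (ι i)
  have hyi : ∀ σ, IsIntegral R (y σ) := fun σ =>
    IsIntegral.sum _ fun i _ => IsIntegral.sum _ fun s _ =>
      (IsIntegral.sum _ fun k _ => ((isIntegral_algebraMap).pow _).mul
        (hιK i _).tower_top).mul (hint i _)
  have hcE : algebraMap R Ω c = algebraMap E Ω (algebraMap R E c) :=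
    IsScalarTower.algebraMap_apply R E Ω c
  have hys : ∀ σ, IsSeparable E (y σ) := fun σ => by
    rw [← mem_separableClosure_iff]
    refine sum_mem fun i _ => sum_mem fun s _ => mul_mem (sum_mem fun k _ =>
      mul_mem (pow_mem ?_ _) ?_) (mem_separableClosure_iff.2 (hus i _))
    · rw [hcE]; exact IntermediateField.algebraMap_mem _ _
    · rw [mem_separableClosure_iff]
      refine IsSeparable.tower_top (F := K) E ?_
      exact IsSeparable.map (ι i) (ι i).toRingHom.injective
        (Algebra.IsSeparable.isSeparable K (s (b i k)))
  have hperm : ∀ β : Ω ≃ₐ[E] Ω, ∃ π : Equiv.Perm G, ∀ σ, β (y σ) = y (π σ) := by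
    intro β
    choose β' hβ' using fun i => exists_restrict_of_normal (ι i) (β.restrictScalars K)
    have hroot : ∀ i x, aeval x ((q i).map (algebraMap R E)) = 0 ↔ ∃ s, u i s = x := fun i x =>
      aeval_eq_zero_iff_of_map_eq_prod (by
        rw [Polynomial.map_map, ← IsScalarTower.algebraMap_eq R E Ω, hq])
    choose π hπ using fun i => exists_perm_of_algEquiv (hu i) (hroot i) β
    refine ⟨(Equiv.mulLeft π).trans (Equiv.mulRight (fun i => Equiv.mulLeft (β' i))⁻¹),
      fun σ => ?_⟩
    have h1 := map_twistedSum (β : Ω →+* Ω) μ u σ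
    simp only [RingHom.coe_coe] at h1
    rw [h1]
    refine twistedSum_eq_of_perm (fun i => Equiv.mulLeft (β' i)) π (fun i s => ?_) hπ σ
    simp only [hμ, conjFamily, map_sum, map_mul, map_pow, hcE, AlgEquiv.commutes]
    exact Finset.sum_congr rfl fun k _ => congrArg _ (hβ' i _)
  have htrans : ∀ S : Finset Ω, (∀ s ∈ S, IsIntegral K s) → ∀ σ,
      ∃ α : Ω ≃ₐ[E] Ω, α (y 1) = y σ ∧ ∀ s ∈ S, α s = s := by
    intro S hS σ
    obtain ⟨α, hα, hfix⟩ := haut σ (S ∪ Finset.univ.image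
      fun p : Σ i, Fin (Module.finrank K (L i)) => ι p.1 (b p.1 p.2)) (by
        intro x hx
        rcases Finset.mem_union.1 hx with hx | hx
        · exact hS x hx
        · obtain ⟨p, -, rfl⟩ := Finset.mem_image.1 hx
          exact hιK _ _)
    have hαι : ∀ i x, α (ι i x) = ι i x := by
      intro i x
      have h1 : ((α.restrictScalars K : Ω →ₐ[K] Ω).comp (ι i)).toLinearMap =
          (ι i).toLinearMap := (b i).ext fun k =>
        hfix _ (Finset.mem_union_right _ (Finset.mem_image.2 ⟨⟨i, k⟩, Finset.mem_univ _, rfl⟩))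
      exact congrArg (fun g => g x) h1
    refine ⟨α, ?_, fun s hs => hfix s (Finset.mem_union_left _ hs)⟩
    have h1 := map_twistedSum (α : Ω →+* Ω) μ u 1
    simp only [RingHom.coe_coe] at h1
    rw [h1]
    refine (twistedSum_eq_of_perm (μ := μ) (τ := u) 1 σ (fun i s => ?_) hα 1).trans
      (by simp [hydef])
    have hαc : α (algebraMap R Ω c) = algebraMap R Ω c := by rw [hcE]; exact α.commutes _
    simp only [hμ, conjFamily, map_sum, map_mul, map_pow, hαc, hαι]
    rfl
  obtain ⟨h, e⟩ := exists_map_eq_prod_X_sub_C (R := R) hys hyi hperm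
  obtain ⟨D, hDb, hD⟩ := exists_discriminant hRΩ e
  have hyw : ∀ σ ∈ Finset.univ, HasWeight (Fin n) K w (y σ) := fun σ _ => by
    rw [← hwdef]
    refine HasWeight.sum fun i _ => HasWeight.sum fun s _ => HasWeight.mul ?_ (hw i _)
    refine HasWeight.sum fun k _ => ?_
    have h1 := ((hasWeight_algebraMap (Ω := Ω) hc).pow (ex ⟨i, k⟩)).mul
      (hasWeight_of_isIntegral (σ := Fin n) (hιK i (s (b i k))))
    exact h1.mono (Nat.mul_le_mul_left _ (hB _))
  have hcardN : (Finset.univ : Finset G).card = N := hN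
  refine ⟨h, D, monic_of_map_eq_prod_X_sub_C _ hRΩ _ _ e, ?_, fun k => ?_, ?_, ?_,
    fun g hg hDg => coverAlgebra_properties hy hys e hperm htrans hDb hg hDg,
    fun a ha => points_of_specialization hRΩ hq e hDb ha⟩
  · rw [natDegree_of_map_eq_prod_X_sub_C _ hRΩ _ _ e, hcardN]
  · refine totalDegree_le_of_hasWeight hRΩ ?_
    rw [← coeff_map, e, ← hcardN]
    exact HasWeight.coeff_prod_X_sub_C hyw k
  · rw [← map_ne_zero_iff _ hRΩ, hD]
    refine Finset.prod_ne_zero_iff.2 fun σ _ => Finset.prod_ne_zero_iff.2 fun τ hτ => ?_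
    exact sub_ne_zero.2 fun h => (Finset.ne_of_mem_erase hτ) (hy h).symm
  · refine totalDegree_le_of_hasWeight hRΩ ?_
    rw [hD]
    rw [← hcardN]
    refine HasWeight.prod fun σ _ => ?_
    refine (HasWeight.prod (m := w) fun τ _ => (hyw σ (Finset.mem_univ _)).sub
      (hyw τ (Finset.mem_univ _))).mono (Nat.mul_le_mul_left _ ?_)
    exact Finset.card_le_card (Finset.erase_subset _ _)

end Cover

/-! ### The bound for the degrees -/

section Bound

/-- The bound for the degrees of the equations of the covering in terms of the sum `D` of the total
degrees of the given polynomials: `F` bounds the degree `∏ (d_i)!` of the covering, and `w` the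
weight of the twisted sums. -/
def degreeBound (D : ℕ) : ℕ :=
  let F := D.factorial
  let w := F ^ 2 * D * D + D
  2 * (w * F * F + D) + w * F + F + 2

theorem primrec_factorial : Primrec Nat.factorial := by
  refine (Primrec.nat_rec₁ (f := fun n m => (n + 1) * m) 1 ?_).of_eq fun n => ?_
  · exact Primrec.nat_mul.comp (Primrec.succ.comp Primrec.fst) Primrec.snd
  · induction n with
    | zero => rfl
    | succ n ih => rw [Nat.factorial_succ, ← ih]

theorem computable_degreeBound : Computable degreeBound := by
  have hF := primrec_factorial
  have hI : Primrec (fun D : ℕ => D) := Primrec.id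
  have hw : Primrec fun D : ℕ => D.factorial * D.factorial * D * D + D :=
    Primrec.nat_add.comp (Primrec.nat_mul.comp (Primrec.nat_mul.comp
      (Primrec.nat_mul.comp hF hF) hI) hI) hI
  have h1 : Primrec fun D : ℕ =>
      2 * ((D.factorial * D.factorial * D * D + D) * D.factorial * D.factorial + D) +
        (D.factorial * D.factorial * D * D + D) * D.factorial + D.factorial + 2 :=
    Primrec.nat_add.comp (Primrec.nat_add.comp (Primrec.nat_add.comp
      (Primrec.nat_mul.comp (Primrec.const 2) (Primrec.nat_add.comp
        (Primrec.nat_mul.comp (Primrec.nat_mul.comp hw hF) hF) hI))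
      (Primrec.nat_mul.comp hw hF)) hF) (Primrec.const 2)
  exact (h1.of_eq fun D => by simp only [degreeBound, pow_two]).to_comp

end Bound

/-! ### Generators of the given extensions -/

section Generators

variable {K : Type u} [Field K] {L : Type v} [Field L] [Algebra K L]

/-- The minimal polynomial of a generating root divides `q` and has the same degree. -/
theorem irreducible_of_generatedByRoot [FiniteDimensional K L] {q : K[X]}
    (hq : q.natDegree = Module.finrank K L) (h : GeneratedByRoot L q) : Irreducible q := by
  obtain ⟨x, hx, htop⟩ := h
  have hint : IsIntegral K x := Algebra.IsIntegral.isIntegral x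
  have hdeg : (minpoly K x).natDegree = q.natDegree := by
    rw [hq, ← adjoin.finrank hint, htop, finrank_top']
  have hq0 : q ≠ 0 := by
    rintro rfl
    rw [natDegree_zero] at hq
    exact Module.finrank_pos.ne hq
  obtain ⟨c, hc⟩ := minpoly.dvd K x hx
  have hc0 : c ≠ 0 := right_ne_zero_of_mul (hc ▸ hq0)
  have hcdeg : c.natDegree = 0 := by
    have h1 := natDegree_mul (minpoly.ne_zero hint) hc0
    rw [← hc, hdeg] at h1
    omega
  have hcu : IsUnit c := by
    rw [eq_C_of_natDegree_eq_zero hcdeg] at hc0 ⊢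
    exact isUnit_C.2 (Ne.isUnit fun h => hc0 (by rw [h, C_0]))
  rw [hc]
  exact (irreducible_mul_isUnit hcu).2 (minpoly.irreducible hint)

theorem adjoin_algebraMap_mul {c : K} (hc : c ≠ 0) (x : L) : K⟮algebraMap K L c * x⟯ = K⟮x⟯ := by
  refine le_antisymm ?_ ?_
  · rw [adjoin_simple_le_iff]
    exact mul_mem (IntermediateField.algebraMap_mem K⟮x⟯ c) (mem_adjoin_simple_self K x)
  · rw [adjoin_simple_le_iff]
    have h1 : x = algebraMap K L c⁻¹ * (algebraMap K L c * x) := by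
      rw [← mul_assoc, ← map_mul, inv_mul_cancel₀ hc, map_one, one_mul]
    have h2 := mul_mem (IntermediateField.algebraMap_mem K⟮algebraMap K L c * x⟯ c⁻¹)
      (mem_adjoin_simple_self K (algebraMap K L c * x))
    rwa [← h1] at h2

/-- The roots of the integral normalization are those of `f` times the leading coefficient. -/
theorem generatedByRoot_integralNormalization {n : ℕ} {f : (MvPolynomial (Fin n) K)[X]}
    (hf : 1 ≤ f.natDegree) {a : Fin n → K} (ha : MvPolynomial.eval a f.leadingCoeff ≠ 0) :
    GeneratedByRoot L (specialize f.integralNormalization a) ↔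
      GeneratedByRoot L (specialize f a) := by
  set c := MvPolynomial.eval a f.leadingCoeff with hc
  have hcL : algebraMap K L c ≠ 0 := (_root_.map_ne_zero _).2 ha
  have key : ∀ x : L, aeval (algebraMap K L c * x) (specialize f.integralNormalization a) = 0 ↔
      aeval x (specialize f a) = 0 := by
    intro x
    have h1 := integralNormalization_eval₂_leadingCoeff_mul hf
      ((algebraMap K L).comp (MvPolynomial.eval a)) x
    rw [specialize, specialize, aeval_def, aeval_def, eval₂_map, eval₂_map]
    rw [RingHom.comp_apply] at h1
    rw [h1, mul_eq_zero_iff_left (pow_ne_zero _ hcL)]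
  constructor
  · rintro ⟨x, hx, htop⟩
    have hx' : x = algebraMap K L c * (algebraMap K L c⁻¹ * x) := by
      rw [← mul_assoc, ← map_mul, mul_inv_cancel₀ ha, map_one, one_mul]
    refine ⟨algebraMap K L c⁻¹ * x, (key _).1 (hx' ▸ hx), ?_⟩
    rw [adjoin_algebraMap_mul (inv_ne_zero ha), htop]
  · rintro ⟨x, hx, htop⟩
    exact ⟨_, (key x).2 hx, by rw [adjoin_algebraMap_mul ha, htop]⟩

end Generators

end

theorem lemma2p8 :
    ∃ p : ℕ → ℕ, Computable p ∧
    ∀ (K : Type u) [Field K] (n r : ℕ) (f : Fin r → (MvPolynomial (Fin n) K)[X])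
      (L : Fin r → Type v) [∀ i, Field (L i)] [∀ i, Algebra K (L i)]
      [∀ i, FiniteDimensional K (L i)] [∀ i, IsGalois K (L i)] (d : Fin r → ℕ),
      (∀ i, AbsolutelyIrreducible (f i)) →
      (∀ i, (overRatFunc (f i)).Separable) →
      (∀ i, (f i).natDegree = d i) →
      (∀ i, Module.finrank K (L i) = d i) →
      -- the Galois group of the splitting field `F` of `f_1 ⋯ f_r` over `K(A)`
      Nonempty ((overRatFunc (∏ i, f i)).Gal ≃* ((i : Fin r) → Equiv.Perm (Fin (d i)))) →
      -- `F` is a regular extension of `K`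
      algebraicClosure K (overRatFunc (∏ i, f i)).SplittingField = ⊥ →
      ∃ (g : MvPolynomial (Fin n) K) (s : Finset (MvPolynomial (Fin (n + 3)) K))
        (I : Ideal (MvPolynomial (Fin (n + 3)) K)) (ρ : OpenCoordRing g →ₐ[K] CoordRing I),
        g ≠ 0 ∧
        IsAbsIrredVariety K (CoordRing I) ∧
        IsNormalVariety (CoordRing I) ∧
        ρ.toRingHom.Finite ∧
        ρ.toRingHom.Etale ∧
        -- (a)
        (I = Ideal.span (s : Set (MvPolynomial (Fin (n + 3)) K)) ∧
          g.totalDegree + ∑ q ∈ s, q.totalDegree ≤ p (∑ i, totalDeg (f i))) ∧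
        -- (b)
        (∀ a ∈ openPoints g, ∀ i, (specialize (f i) a).natDegree = d i) ∧
        -- (c)
        (Set.range (mapPoint ρ) =
          {a | a ∈ openPoints g ∧ ∀ i, GeneratedByRoot (L i) (specialize (f i) a)}) ∧
        (∀ a ∈ Set.range (mapPoint ρ), ∀ i,
          Irreducible (specialize (f i) a) ∧ (specialize (f i) a).natDegree = d i) ∧
        -- (d)
        (∀ a ∈ Set.range (mapPoint ρ),
          {b : MvPolynomial.zeroLocus K I | mapPoint ρ b = a}.ncard = ∏ i, d i) := by
  classical
  refine ⟨degreeBound, computable_degreeBound, ?_⟩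
  intro K _ n r f L _ _ _ _ d _ hsep hdeg hL hgal hreg
  have hd : ∀ i, 0 < d i := fun i => hL i ▸ Module.finrank_pos
  have hf0 : ∀ i, f i ≠ 0 := fun i h => by
    have := hdeg i
    rw [h, natDegree_zero] at this
    exact absurd this (hd i).ne
  have hcard : ∀ i, Fintype.card (L i ≃ₐ[K] L i) = d i := fun i => by
    rw [← Nat.card_eq_fintype_card, IsGalois.card_aut_eq_finrank, hL]
  set S := ∑ i, totalDeg (f i) with hS
  have hfS : ∀ i, totalDeg (f i) ≤ S := fun i =>
    Finset.single_le_sum (f := fun i => totalDeg (f i)) (fun _ _ => Nat.zero_le _)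
      (Finset.mem_univ i)
  obtain ⟨u, hq, hu, hus, haut⟩ := exists_roots hcard hd hsep hdeg hgal hreg
  have hw : ∀ i s, HasWeight (Fin n) K S (u i s) := fun i s =>
    (hasWeight_root_integralNormalization (hf0 i)
      (aeval_eq_zero_of_map_eq_prod (hq i))).mono (hfS i)
  obtain ⟨h, D, hmonic, hhdeg, hhcoeff, hD0, hDdeg, hprop, hpts⟩ :=
    exists_cover_polynomial hq hu hus haut hw rfl rfl rfl
  have hdS : ∑ i, d i ≤ S := Finset.sum_le_sum fun i _ => hdeg i ▸ natDegree_le_totalDeg (f i)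
  have hB : ∑ i, Module.finrank K (L i) ≤ S := by simpa only [hL] using hdS
  have hN : Fintype.card (∀ i, Equiv.Perm (L i ≃ₐ[K] L i)) ≤ S.factorial := by
    rw [Fintype.card_pi]
    simp only [Fintype.card_perm, hcard]
    exact (Nat.le_of_dvd (Nat.factorial_pos _)
      (Nat.prod_factorial_dvd_factorial_sum _ _)).trans (Nat.factorial_le hdS)
  set N := Fintype.card (∀ i, Equiv.Perm (L i ≃ₐ[K] L i))
  set B := ∑ i, Module.finrank K (L i)
  let g : MvPolynomial (Fin n) K := D * ∏ i, (f i).leadingCoeff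
  have hg0 : g ≠ 0 := mul_ne_zero hD0
    (Finset.prod_ne_zero_iff.2 fun i _ => leadingCoeff_ne_zero.2 (hf0 i))
  have hgD : ∀ a ∈ openPoints g, MvPolynomial.eval a D ≠ 0 := fun a ha => by
    have h1 : MvPolynomial.eval a (D * _) ≠ 0 := ha
    rw [map_mul] at h1
    exact left_ne_zero_of_mul h1
  have hglc : ∀ a ∈ openPoints g, ∀ i, MvPolynomial.eval a (f i).leadingCoeff ≠ 0 :=
    fun a ha i => by
    have h1 : MvPolynomial.eval a (D * _) ≠ 0 := ha
    rw [map_mul, map_prod] at h1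
    exact Finset.prod_ne_zero_iff.1 (right_ne_zero_of_mul h1) i (Finset.mem_univ i)
  have hspec : ∀ a ∈ openPoints g, ∀ i, (specialize (f i) a).natDegree = d i := fun a ha i =>
    (natDegree_map_of_leadingCoeff_ne_zero _ (hglc a ha i)).trans (hdeg i)
  have hgen : ∀ a ∈ openPoints g, ((∃ η, (specialize h a).eval η = 0) ↔
      ∀ i, GeneratedByRoot (L i) (specialize (f i) a)) := fun a ha =>
    (hpts a (hgD a ha)).1.trans (forall_congr' fun i =>
      generatedByRoot_integralNormalization ((hdeg i).symm ▸ hd i) (hglc a ha i))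
  obtain ⟨het, hdom, hic, hgdom⟩ := hprop g hg0 (dvd_mul_right _ _)
  refine ⟨g, coverEquations g h, coverIdeal g h, coverProjection g h, hg0,
    isAbsIrredVariety_coordRing g h hgdom, isNormalVariety_coordRing g h hdom hic,
    coverProjection_finite g h hmonic, coverProjection_etale g h het, ⟨rfl, ?_⟩, hspec,
    ?_, ?_, ?_⟩
  · have hgdeg : g.totalDegree ≤ (N ^ 2 * B * B + S) * N * N + S := by
      refine (MvPolynomial.totalDegree_mul _ _).trans (Nat.add_le_add hDdeg ?_)
      exact (MvPolynomial.totalDegree_finsetProd _ _).trans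
        (Finset.sum_le_sum fun i _ => totalDegree_coeff_le_totalDeg (f i) _)
    have hs := totalDegree_sum_coverEquations_le g h hhcoeff
    rw [hhdeg] at hs
    have hw : N ^ 2 * B * B + S ≤ S.factorial ^ 2 * S * S + S := by gcongr
    have hwN := Nat.mul_le_mul hw hN
    have hwNN := Nat.mul_le_mul hwN hN
    simp only [degreeBound]
    omega
  · ext a
    rw [mem_range_mapPoint]
    exact and_congr_right fun ha => hgen a ha
  · intro a ha i
    obtain ⟨hag, hη⟩ := (mem_range_mapPoint g h a).1 ha
    exact ⟨irreducible_of_generatedByRoot ((hspec a hag i).trans (hL i).symm)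
      ((hgen a hag).1 hη i), hspec a hag i⟩
  · intro a ha
    obtain ⟨hag, hη⟩ := (mem_range_mapPoint g h a).1 ha
    have h1 := (hpts a (hgD a hag)).2 hη
    simp only [hL] at h1
    rw [← h1, ← (bijOn_fibre g h hag).image_eq]
    exact (bijOn_fibre g h hag).injOn.ncard_image.symm
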